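/- A Delaunay polytope in $\mathbb{R}^n$ is the convex hull of $S\cap L$, where $L\subset\mathbb{R}^n$ is an $n$-dimensional lattice and $S=S(c,r)$ is a sphere such that $\|v-c\|\ge r$ for all $v\in L$ and $S\cap L$ affinely spans $\mathbb{R}^n$. It is extreme if every affine bijection $f$ of $\mathbb{R}^n$ for which $f(P)$ is again a Delaunay polytope is a homothety followed by an isometry. For $n\ge 2$ let $V(P_n)$ consist of the point $(\frac12,\dots,\frac12,1)$, the points $(x_1,\dots,x_{n-1},0)$ with $x_i\in\{0,1\}$ and $\sum x_i$ even, and the points $(\frac12,\dots,\frac12,-1)\pm e_j$ with $1\le j\le n-1$. For even $n\ge 6$ let $P_n$ be the convex hull of $V(P_n)$, where $\mathbb{R}^n$ carries the Euclidean structure of the quadratic form $x_1^2+\dots+x_{n-1}^2+\frac{n-3}{4}x_n^2$ (equivalently, the last coordinate is multiplied by $\frac{\sqrt{n-3}}{2}$ and the standard structure is used). Let $V\subset\mathbb{R}^m$ be the vertex set of a Delaunay polytope with circumcentre $c$. For $t>0$ let $M_t\subset\mathbb{R}^{m+1}$ be the group generated by $V\times\{0\}$ and $(2c-V)\times\{t\}$,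 and let $S_t$ be the sphere with centre $(c,t/2)$ through these points. The symmetric extension of $V$ is the convex hull of $S_t\cap M_t$ for the least $t>0$ for which no point of $M_t$ lies inside $S_t$. For $n\ge 6$ let $ED_n=P_n$ if $n$ is even, and let $ED_n$ be the symmetric extension of $V(P_{n-1})$ if $n$ is odd. Then: (1) for even $m\ge 6$ the set $V(P_m)$ lies on a sphere and the least $t$ in the definition of its symmetric extension exists, so that $ED_{m+1}$ is well defined; (2) for every $n\ge 6$, $ED_n$ is an extreme Delaunay polytope of dimension $n$; (3) $ED_6$ is congruent to the Schläfli polytope $2_{21}$ (the convex hull of the $27$ roots $x$ of $E_8$ with $x\cdot a=x\cdot b=1$, where $a,b$ are roots with $a\cdot b=1$), and $ED_7$ is congruent to the Gosset polytope $3_{21}$ (the convex hull of the $56$ roots $x$ of $E_8$ with $x\cdot a=1$, where $a$ is a root); here roots have squared length $2$. -/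

import Mathlib

namespace ExtremeDelaunay

/-- Euclidean `n`-space. -/
abbrev E (n : ℕ) : Type := EuclideanSpace ℝ (Fin n)

/-- `P` is a Delaunay polytope: the convex hull of the points of an `n`-dimensional lattice `L`
that lie on a sphere `S(c, r)` which is empty in `L` (no lattice point is at distance less than `r`
from `c`, and `S(c, r) ∩ L` has affine rank `n + 1`, that is, it affinely spans the space). -/
def IsDelaunay {n : ℕ} (P : Set (E n)) : Prop :=
  ∃ (L : Submodule ℤ (E n)) (_ : DiscreteTopology L) (_ : IsZLattice ℝ L) (c : E n) (r : ℝ),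
    (∀ v ∈ L, r ≤ dist v c) ∧
    affineSpan ℝ (Metric.sphere c r ∩ (L : Set (E n))) = ⊤ ∧
    P = convexHull ℝ (Metric.sphere c r ∩ (L : Set (E n)))

/-- A Delaunay polytope is extreme if every affine bijection that maps it to a Delaunay polytope
is a homothety followed by an isometry. -/
def IsExtremeDelaunay {n : ℕ} (P : Set (E n)) : Prop :=
  IsDelaunay P ∧
    ∀ f : E n ≃ᵃ[ℝ] E n, IsDelaunay (f '' P) →
      ∃ (g : E n ≃ᵃⁱ[ℝ] E n) (a : E n) (k : ℝ), 0 < k ∧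
        ∀ x, f x = g (AffineMap.homothety a k x)

/-- The point `(y, h)` of `ℝᵐ × ℝ = ℝᵐ⁺¹`. -/
noncomputable def point {m : ℕ} (y : Fin m → ℝ) (h : ℝ) : E (m + 1) :=
  WithLp.toLp 2 (Fin.snoc (α := fun _ => ℝ) y h)

/-- The point with coordinates `(y, h)` in `ℝⁿ`, `n = m + 1`, when `ℝⁿ` carries the quadratic form
`x₁² + ⋯ + xₙ₋₁² + ((n - 3) / 4) xₙ²`: the last axis is rescaled by `√(n - 3) / 2`, so that this
form becomes the standard Euclidean one. -/
noncomputable def qPoint {m : ℕ} (y : Fin m → ℝ) (h : ℝ) : E (m + 1) :=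
  point y (Real.sqrt (((m + 1 : ℕ) : ℝ) - 3) / 2 * h)

/-- The vertices of `Pₙ`, in three layers: one vertex at height `1`, the half-cube at height `0`
and a cross-polytope at height `-1`. -/
def pVertices : (n : ℕ) → Set (E n)
  | 0 => ∅
  | m + 1 =>
    {qPoint (fun _ : Fin m => (1 / 2 : ℝ)) 1} ∪
    {p | ∃ x : Fin m → ℕ, (∀ i, x i = 0 ∨ x i = 1) ∧ Even (∑ i, x i) ∧
        p = qPoint (fun i => (x i : ℝ)) 0} ∪
    {p | ∃ j : Fin m,
        p = qPoint ((fun _ : Fin m => (1 / 2 : ℝ)) + Pi.single j 1) (-1) ∨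
        p = qPoint ((fun _ : Fin m => (1 / 2 : ℝ)) - Pi.single j 1) (-1)}

/-- The polytope `Pₙ`. -/
def P (n : ℕ) : Set (E n) := convexHull ℝ (pVertices n)

/-- `c` is a centre of a sphere that contains `V`. -/
def IsCircumcentre {m : ℕ} (V : Set (E m)) (c : E m) : Prop :=
  ∃ r : ℝ, V ⊆ Metric.sphere c r

/-- The centre of the sphere circumscribed to `V` (unique if `V` affinely spans the space). -/
noncomputable def circumcentre {m : ℕ} (V : Set (E m)) : E m :=
  Classical.epsilon (IsCircumcentre V)

/-- The group generated by the copy `V × {0}` of `V` and by the copy `(2c - V) × {t}` of its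
reflection in `c`. If `V` generates the lattice `L`, then the layer of this group at height `k t`
is `L + 2 k c`. -/
def extLattice {m : ℕ} (V : Set (E m)) (c : E m) (t : ℝ) : AddSubgroup (E (m + 1)) :=
  AddSubgroup.closure
    ((fun v : E m => point v 0) '' V ∪ (fun v : E m => point ((2 : ℝ) • c - v) t) '' V)

/-- The heights `t > 0` for which the sphere with centre `(c, t / 2)` that passes through `V × {0}`
(and through `(2c - V) × {t}`) has no point of `extLattice V c t` in its interior. -/
def admissibleHeights {m : ℕ} (V : Set (E m)) (c : E m) : Set ℝ :=
  {t | 0 < t ∧ ∀ x ∈ extLattice V c t, ∀ v ∈ V,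
    dist (point v 0) (point c (t / 2)) ≤ dist x (point c (t / 2))}

/-- The points of `extLattice V c t` on the sphere with centre `(c, t / 2)` through `V × {0}`. -/
def extVertices {m : ℕ} (V : Set (E m)) (c : E m) (t : ℝ) : Set (E (m + 1)) :=
  {x | x ∈ extLattice V c t ∧ ∀ v ∈ V,
    dist x (point c (t / 2)) = dist (point v 0) (point c (t / 2))}

/-- The centrally symmetric polytope of dimension `m + 1` obtained from the polytope of dimension
`m` with vertex set `V`: `V` and its reflection are put into parallel hyperplanes, which are moved
as close together as the emptiness of the common sphere permits. -/
noncomputable def symmetricExtension {m : ℕ} (V : Set (E m)) : Set (E (m + 1)) :=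
  convexHull ℝ (extVertices V (circumcentre V) (sInf (admissibleHeights V (circumcentre V))))

/-- The construction of `symmetricExtension` applies to `V`: there is a circumscribed sphere and
the least admissible height is attained. -/
def HasSymmetricExtension {m : ℕ} (V : Set (E m)) : Prop :=
  IsCircumcentre V (circumcentre V) ∧
  ∃ t, IsLeast (admissibleHeights V (circumcentre V)) t

open Classical in
/-- The polytope `EDₙ` (meant for `n ≥ 6`). -/
noncomputable def ED : (n : ℕ) → Set (E n)
  | 0 => P 0
  | m + 1 => if Even (m + 1) then P (m + 1) else symmetricExtension (pVertices m)

/-- The 240 roots of the lattice `E₈`: the vectors of squared length `2` with even coordinate sum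
whose coordinates are all in `ℤ` or all in `ℤ + 1/2`. -/
def rootsE8 : Set (E 8) :=
  {x | ((∀ i, ∃ a : ℤ, x i = a) ∨ (∀ i, ∃ a : ℤ, x i = a + 1 / 2)) ∧
    (∃ a : ℤ, ∑ i, x i = 2 * a) ∧ ∑ i, x i ^ 2 = 2}

/-- The Gosset polytope `3₂₁`: the convex hull of the 56 roots of `E₈` that have inner product `1`
with the root `e₀ + e₁`, that is, the vertex figure of the polytope `4₂₁`. -/
def gosset : Set (E 8) := convexHull ℝ {x | x ∈ rootsE8 ∧ x 0 + x 1 = 1}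

/-- The Schläfli polytope `2₂₁`: the convex hull of the 27 roots of `E₈` that have inner product `1`
with the roots `e₀ + e₁` and `e₀ + e₂`, that is, the vertex figure of the polytope `3₂₁`. -/
def schlafli : Set (E 8) := convexHull ℝ {x | x ∈ rootsE8 ∧ x 0 + x 1 = 1 ∧ x 0 + x 2 = 1}

/-- `A` and `B` are congruent: an isometry of the Euclidean spaces maps `A` onto `B`. -/
def Congruent {m n : ℕ} (A : Set (E m)) (B : Set (E n)) : Prop :=
  ∃ f : E m →ᵃⁱ[ℝ] E n, f '' A = B

end ExtremeDelaunay

/-! Extremality comes from one rigidity statement. The vertex sets in both families contain the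
pattern `IsLayered`: a half-cube of dimension at least 5 with orthonormal edges `v j` and centre
`β`, the cross-polytope `β ± v j - w`, and one point above, `β + w` or `β + v j + w`, where `w` is
orthogonal to all `v j`. If an affine image of the pattern lies on a sphere, the half-cube forces
the image edges to be orthogonal. The cross-polytope then forces them to have equal length and to be
orthogonal to the image of `w`, and the upper point fixes the length of that image
(`gram_of_layers`). Hence the linear part is a similarity. An affine bijection onto a Delaunay
polytope carries vertices to vertices, which lie on a sphere, so the statement applies
(`IsLayered.isExtremeDelaunay`).

It remains to see that the polytopes are Delaunay. In even dimension `N + 1`, the squared distance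
of a lattice point from the centre, less the squared radius, is an explicit integer expression. It
is nonnegative because `N` is odd, and it vanishes exactly at the vertices (`pLattice_defect`). In
odd dimension `N + 2`, the corresponding expression for the extended lattice depends on `t` through
a single term, and `t² = 1 - 1/(N - 2)` makes it a nonnegative integer (`ext_defect_nonneg`). A
point of the layer below the two copies of `V` would enter the sphere for smaller `t`, so this
height is the least. At this height that point joins the vertices and completes a layered pattern
whose half-cube has dimension `N + 1` (`isLayered_extVertices`).

For `N = 5` an explicit isometric embedding identifies the extended lattice with a slice of `E₈`,
its sphere with the condition of squared length 2, and its bottom layer with the second root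
condition. -/

namespace ExtremeDelaunay

open scoped RealInnerProductSpace

/-! ### Rigidity of the Gram matrix of a layered configuration on a sphere. -/

section Gram

variable {F : Type*} [NormedAddCommGroup F] [InnerProductSpace ℝ F]

/-- Five vectors whose even partial sums, shifted by `b`, lie on a sphere are orthogonal. -/
theorem inner_eq_zero_of_even_sums {a₁ a₂ a₃ a₄ a₅ b : F} {ρ : ℝ}
    (h₀ : ‖b‖ ^ 2 = ρ) (h₁₂ : ‖b + (a₁ + a₂)‖ ^ 2 = ρ) (h₁₃ : ‖b + (a₁ + a₃)‖ ^ 2 = ρ)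
    (h₁₄ : ‖b + (a₁ + a₄)‖ ^ 2 = ρ) (h₁₅ : ‖b + (a₁ + a₅)‖ ^ 2 = ρ)
    (h₂₃ : ‖b + (a₂ + a₃)‖ ^ 2 = ρ) (h₂₄ : ‖b + (a₂ + a₄)‖ ^ 2 = ρ)
    (h₂₅ : ‖b + (a₂ + a₅)‖ ^ 2 = ρ) (h₃₄ : ‖b + (a₃ + a₄)‖ ^ 2 = ρ)
    (h₃₅ : ‖b + (a₃ + a₅)‖ ^ 2 = ρ) (h₄₅ : ‖b + (a₄ + a₅)‖ ^ 2 = ρ)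
    (h₁₂₃₄ : ‖b + (a₁ + a₂ + a₃ + a₄)‖ ^ 2 = ρ) (h₁₂₃₅ : ‖b + (a₁ + a₂ + a₃ + a₅)‖ ^ 2 = ρ)
    (h₁₂₄₅ : ‖b + (a₁ + a₂ + a₄ + a₅)‖ ^ 2 = ρ) (h₁₃₄₅ : ‖b + (a₁ + a₃ + a₄ + a₅)‖ ^ 2 = ρ)
    (h₂₃₄₅ : ‖b + (a₂ + a₃ + a₄ + a₅)‖ ^ 2 = ρ) : ⟪a₁, a₂⟫ = 0 := by
  simp only [norm_add_sq_real, inner_add_left, inner_add_right] at *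
  -- The sign of the subset `S` is the character `(-1)^|S ∩ {1, 2}|`. The squared norm has degree 2
  -- in the indicators of `S`, and on even subsets of five indices this character agrees only with
  -- that of `{3, 4, 5}`, of degree 3. So only `⟪a₁, a₂⟫` survives; with four indices `⟪a₃, a₄⟫`
  -- would survive too.
  linear_combination (1 / 8 : ℝ) * (h₀ + h₁₂ - h₁₃ - h₁₄ - h₁₅ - h₂₃ - h₂₄ - h₂₅ + h₃₄ + h₃₅ + h₄₅
    + h₁₂₃₄ + h₁₂₃₅ + h₁₂₄₅ - h₁₃₄₅ - h₂₃₄₅)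

variable {ι : Type*} [Fintype ι]

theorem inner_eq_zero_of_half_cube (hι : 5 ≤ Fintype.card ι) {a : ι → F} {b : F} {r : ℝ}
    (half : ∀ S : Finset ι, Even S.card → ‖b + ∑ i ∈ S, a i‖ = r) {i j : ι} (hij : i ≠ j) :
    ⟪a i, a j⟫ = 0 := by
  classical
  obtain ⟨T, hT, hc⟩ := Finset.exists_subset_card_eq (s := (Finset.univ \ {i, j} : Finset ι)) (n := 3)
    (by rw [Finset.card_sdiff_of_subset (Finset.subset_univ _), Finset.card_univ,
          Finset.card_pair hij]; omega)
  obtain ⟨k, l, m, hkl, hkm, hlm, rfl⟩ := Finset.card_eq_three.1 hc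
  simp only [Finset.subset_iff, Finset.mem_insert, Finset.mem_singleton, Finset.mem_sdiff,
    Finset.mem_univ, true_and, forall_eq_or_imp, forall_eq, not_or] at hT
  obtain ⟨⟨hki, hkj⟩, ⟨hli, hlj⟩, hmi, hmj⟩ := hT
  replace hki := Ne.symm hki
  replace hkj := Ne.symm hkj
  replace hli := Ne.symm hli
  replace hlj := Ne.symm hlj
  replace hmi := Ne.symm hmi
  replace hmj := Ne.symm hmj
  have pair : ∀ {p q : ι}, p ≠ q → ‖b + (a p + a q)‖ ^ 2 = r ^ 2 := fun {p q} h => by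
    rw [← half {p, q} (by rw [Finset.card_pair h]; exact even_two), Finset.sum_pair h]
  have quad : ∀ {p q s t : ι}, p ≠ q → p ≠ s → p ≠ t → q ≠ s → q ≠ t → s ≠ t →
      ‖b + (a p + a q + a s + a t)‖ ^ 2 = r ^ 2 := fun {p q s t} h₁ h₂ h₃ h₄ h₅ h₆ => by
    have hp : p ∉ ({q, s, t} : Finset ι) := by simp [h₁, h₂, h₃]
    have hq : q ∉ ({s, t} : Finset ι) := by simp [h₄, h₅]
    rw [← half {p, q, s, t} (by
      rw [Finset.card_insert_of_notMem hp, Finset.card_insert_of_notMem hq, Finset.card_pair h₆]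
      decide), Finset.sum_insert hp, Finset.sum_insert hq, Finset.sum_pair h₆]
    congr 3
    abel
  have zero : ‖b‖ ^ 2 = r ^ 2 := by rw [← half ∅ (by simp)]; simp
  exact inner_eq_zero_of_even_sums zero (pair hij) (pair hki) (pair hli) (pair hmi)
    (pair hkj) (pair hlj) (pair hmj) (pair hkl) (pair hkm) (pair hlm)
    (quad hij hki hli hkj hlj hkl)
    (quad hij hki hmi hkj hmj hkm)
    (quad hij hli hmi hlj hmj hlm)
    (quad hki hli hmi hkl hkm hlm)
    (quad hkj hlj hmj hkl hkm hlm)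

/-- By orthogonality, the pair `{p, q}` gives `q p + q q = 0` for the numbers `2⟪b, a p⟫ + ‖a p‖²`,
here written `q p`. Three pairs among three indices make each of these numbers zero. -/
theorem inner_centre_eq_zero (hι : 5 ≤ Fintype.card ι) {a : ι → F} {b : F} {r : ℝ}
    (half : ∀ S : Finset ι, Even S.card → ‖b + ∑ i ∈ S, a i‖ = r) (i : ι) :
    ⟪b + (1 / 2 : ℝ) • ∑ k, a k, a i⟫ = 0 := by
  classical
  have orth := fun {i j : ι} => inner_eq_zero_of_half_cube hι half (i := i) (j := j)
  have zero : ‖b‖ ^ 2 = r ^ 2 := by rw [← half ∅ (by simp)]; simp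
  have pair : ∀ {p q : ι}, p ≠ q →
      (2 * ⟪b, a p⟫ + ‖a p‖ ^ 2) + (2 * ⟪b, a q⟫ + ‖a q‖ ^ 2) = 0 := fun {p q} h => by
    have := half {p, q} (by rw [Finset.card_pair h]; exact even_two)
    rw [Finset.sum_pair h] at this
    have h2 : ‖b + (a p + a q)‖ ^ 2 = r ^ 2 := by rw [this]
    simp only [norm_add_sq_real, inner_add_right, orth h] at h2
    linear_combination h2 - zero
  obtain ⟨j, hj⟩ := Finset.exists_mem_notMem_of_card_lt_card (s := {i}) (t := (Finset.univ : Finset ι))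
    (by rw [Finset.card_univ, Finset.card_singleton]; omega)
  obtain ⟨k, hk⟩ := Finset.exists_mem_notMem_of_card_lt_card (s := {i, j})
    (t := (Finset.univ : Finset ι)) (by
      have := Finset.card_le_two (a := i) (b := j)
      rw [Finset.card_univ]; omega)
  simp only [Finset.mem_univ, Finset.mem_singleton, Finset.mem_insert, true_and, not_or] at hj hk
  have key : 2 * ⟪b, a i⟫ + ‖a i‖ ^ 2 = 0 := by
    linear_combination (1 / 2 : ℝ) * (pair (Ne.symm hj) + pair (Ne.symm hk.1) - pair (Ne.symm hk.2))
  have hs : ⟪∑ k, a k, a i⟫ = ‖a i‖ ^ 2 := by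
    rw [sum_inner, Finset.sum_eq_single i (fun k _ h => orth h) (by simp),
      real_inner_self_eq_norm_sq]
  rw [inner_add_left, inner_smul_left, hs]
  simp only [conj_trivial]
  linear_combination (1 / 2 : ℝ) * key

theorem norm_sq_sum_smul_of_orthogonal {a : ι → F} {d : ℝ} (hd : ∀ i, ‖a i‖ ^ 2 = d)
    (orth : ∀ i j, i ≠ j → ⟪a i, a j⟫ = 0) (c : ι → ℝ) :
    ‖∑ i, c i • a i‖ ^ 2 = d * ∑ i, c i ^ 2 := by
  classical
  rw [← real_inner_self_eq_norm_sq, sum_inner, Finset.mul_sum]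
  refine Finset.sum_congr rfl fun i _ => ?_
  rw [inner_sum, Finset.sum_eq_single i (fun j _ h => ?_) (by simp), inner_smul_left,
    inner_smul_right, real_inner_self_eq_norm_sq, hd]
  · simp only [conj_trivial]; ring
  · rw [inner_smul_left, inner_smul_right, orth i j h.symm, mul_zero, mul_zero]

/-- The Gram matrix of the vectors that span a layered configuration is determined up to a factor
by the condition that the configuration lies on a sphere. -/
theorem gram_of_layers (hι : 5 ≤ Fintype.card ι) {a : ι → F} {b ω : F} {r ρ : ℝ}
    (half : ∀ S : Finset ι, Even S.card → ‖b + ∑ i ∈ S, a i‖ = r)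
    (lower : ∀ j, ‖b + (1 / 2 : ℝ) • ∑ i, a i + a j - ω‖ = r ∧
      ‖b + (1 / 2 : ℝ) • ∑ i, a i - a j - ω‖ = r)
    (upper : (‖b + (1 / 2 : ℝ) • ∑ i, a i + ω‖ = r ∧ ρ = ((Fintype.card ι : ℝ) - 2) / 4) ∨
      ((∃ j, ‖b + (1 / 2 : ℝ) • ∑ i, a i + a j + ω‖ = r) ∧ ρ = ((Fintype.card ι : ℝ) - 4) / 4)) :
    ∃ d : ℝ, (∀ i, ‖a i‖ ^ 2 = d) ∧ (∀ i j, i ≠ j → ⟪a i, a j⟫ = 0) ∧ (∀ i, ⟪a i, ω⟫ = 0) ∧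
      ‖ω‖ ^ 2 = d * ρ := by
  classical
  have orth : ∀ i j, i ≠ j → ⟪a i, a j⟫ = 0 := fun i j => inner_eq_zero_of_half_cube hι half
  have centre := inner_centre_eq_zero hι half
  have zero : ‖b‖ ^ 2 = r ^ 2 := by rw [← half ∅ (by simp)]; simp
  obtain ⟨β, hβ⟩ : ∃ β, β = b + (1 / 2 : ℝ) • ∑ i, a i := ⟨_, rfl⟩
  simp only [← hβ] at lower upper centre
  -- The sum and the difference of the equations for `β - ω ± a j` give the two claims; the value of
  -- `‖a j‖²` does not depend on `j`.
  have low : ∀ j, ⟪a j, ω⟫ = 0 ∧ ‖a j‖ ^ 2 = r ^ 2 - ‖β - ω‖ ^ 2 := fun j => by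
    have h1 : ‖(β - ω) + a j‖ ^ 2 = r ^ 2 := by rw [← (lower j).1]; congr 2; abel
    have h2 : ‖(β - ω) - a j‖ ^ 2 = r ^ 2 := by rw [← (lower j).2]; congr 2; abel
    rw [norm_add_sq_real, inner_sub_left, centre] at h1
    rw [norm_sub_sq_real, inner_sub_left, centre] at h2
    rw [real_inner_comm]
    constructor <;> linarith
  refine ⟨r ^ 2 - ‖β - ω‖ ^ 2, fun i => (low i).2, orth, fun i => (low i).1, ?_⟩
  obtain ⟨d, hd⟩ : ∃ d, d = r ^ 2 - ‖β - ω‖ ^ 2 := ⟨_, rfl⟩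
  have hnorm : ‖β‖ ^ 2 + Fintype.card ι * d / 4 = r ^ 2 := by
    have hs := norm_sq_sum_smul_of_orthogonal (d := d) (fun i => (low i).2.trans hd.symm) orth
      (fun _ => 1 / 2)
    have hsβ : ⟪β, ∑ i, (1 / 2 : ℝ) • a i⟫ = 0 := by
      rw [inner_sum]
      exact Finset.sum_eq_zero fun i _ => by rw [inner_smul_right, centre, mul_zero]
    have hb : b = β - ∑ i, (1 / 2 : ℝ) • a i := by rw [hβ, Finset.smul_sum]; abel
    rw [hb, norm_sub_sq_real, hsβ, hs] at zero
    simp only [Finset.sum_const, Finset.card_univ, nsmul_eq_mul] at zero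
    linear_combination zero
  -- Here `‖β - ω‖²` and `‖β‖²` are known in terms of `r` and `d`; the upper point supplies `‖β +
  -- ω‖²`, and the parallelogram law yields `‖ω‖²`.
  have hpar : ‖β + ω‖ ^ 2 + ‖β - ω‖ ^ 2 = 2 * (‖β‖ ^ 2 + ‖ω‖ ^ 2) := by
    rw [norm_add_sq_real, norm_sub_sq_real]; ring
  rw [← hd]
  rcases upper with ⟨h, rfl⟩ | ⟨⟨j, h⟩, rfl⟩
  · rw [h] at hpar
    linear_combination - hpar / 2 + hd / 2 - hnorm
  · have h1 : ‖(β + ω) + a j‖ ^ 2 = r ^ 2 := by rw [← h]; congr 2; abel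
    rw [norm_add_sq_real, inner_add_left, centre, real_inner_comm, (low j).1, (low j).2] at h1
    linear_combination - hpar / 2 + h1 / 2 + hd / 2 - hnorm + hd / 2

end Gram

/-! ### Layered sets, extremality, and criteria for Delaunay polytopes and circumcentres. -/

section Extreme

variable {n : ℕ}

/-- A set of points in three layers: a half-cube with origin `o` and edge vectors `v i`, all the
points `o + ∑ v i / 2 ± v j - w`, and one more point above the half-cube. -/
structure IsLayered {ι : Type*} [Fintype ι] (V : Set (E n)) (o : E n) (v : ι → E n) (w : E n) :
    Prop where
  card : 5 ≤ Fintype.card ι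
  half : ∀ x : ι → ℕ, (∀ i, x i = 0 ∨ x i = 1) → Even (∑ i, x i) →
    o + ∑ i, (x i : ℝ) • v i ∈ V
  lower_add : ∀ j, o + (1 / 2 : ℝ) • ∑ i, v i + v j - w ∈ V
  lower_sub : ∀ j, o + (1 / 2 : ℝ) • ∑ i, v i - v j - w ∈ V
  upper : (o + (1 / 2 : ℝ) • ∑ i, v i + w ∈ V ∧ ‖w‖ ^ 2 = ((Fintype.card ι : ℝ) - 2) / 4) ∨
    ((∃ j, o + (1 / 2 : ℝ) • ∑ i, v i + v j + w ∈ V) ∧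
      ‖w‖ ^ 2 = ((Fintype.card ι : ℝ) - 4) / 4)
  norm_eq_one : ∀ i, ‖v i‖ ^ 2 = 1
  orthogonal : ∀ i j, i ≠ j → ⟪v i, v j⟫ = 0
  orthogonal_axis : ∀ i, ⟪v i, w⟫ = 0
  spans : ∀ x, ∃ (c : ι → ℝ) (s : ℝ), x = ∑ i, c i • v i + s • w

namespace IsLayered

variable {ι : Type*} [Fintype ι] {V : Set (E n)} {o w : E n} {v : ι → E n}

theorem half_finset (h : IsLayered V o v w) (S : Finset ι) (hS : Even S.card) :
    o + ∑ i ∈ S, v i ∈ V := by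
  classical
  have := h.half (fun i => if i ∈ S then 1 else 0) (fun i => by split_ifs <;> simp)
    (by simpa using hS)
  simpa [Finset.sum_ite_mem] using this

theorem origin_mem (h : IsLayered V o v w) : o ∈ V := by
  simpa using h.half_finset ∅ (by simp)

theorem norm_sq_linear (h : IsLayered V o v w) (f : E n →ᵃ[ℝ] E n) {c : E n} {r : ℝ}
    (hf : ∀ x ∈ V, dist (f x) c = r) : ∃ d : ℝ, ∀ x, ‖f.linear x‖ ^ 2 = d * ‖x‖ ^ 2 := by
  have hV : ∀ x, o + x ∈ V → ‖(f o - c) + f.linear x‖ = r := fun x hx => by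
    have hx' : f (o + x) = f.linear x + f o := by
      rw [add_comm, ← vadd_eq_add, f.map_vadd, vadd_eq_add]
    rw [← hf _ hx, dist_eq_norm, hx']
    congr 1
    abel
  -- Taking `ρ = ‖w‖²` makes the Gram matrix of the images `d` times that of the orthogonal spanning
  -- vectors `v i`, `w`.
  obtain ⟨d, h1, h2, h3, h4⟩ := gram_of_layers (ρ := ‖w‖ ^ 2) h.card (a := fun i => f.linear (v i))
    (b := f o - c) (ω := f.linear w) (r := r)
    (fun S hS => by simpa [map_sum] using hV _ (h.half_finset S hS))
    (fun j => by
      constructor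
      · simpa [map_sum, add_assoc, sub_eq_add_neg] using hV ((1 / 2 : ℝ) • ∑ i, v i + v j - w)
          (by simpa [add_assoc, sub_eq_add_neg] using h.lower_add j)
      · simpa [map_sum, add_assoc, sub_eq_add_neg] using hV ((1 / 2 : ℝ) • ∑ i, v i - v j - w)
          (by simpa [add_assoc, sub_eq_add_neg] using h.lower_sub j))
    (by
      refine h.upper.imp (fun hu => ⟨?_, hu.2⟩) (fun hu => ⟨?_, hu.2⟩)
      · simpa [map_sum, add_assoc] using hV ((1 / 2 : ℝ) • ∑ i, v i + w)
          (by simpa [add_assoc] using hu.1)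
      · obtain ⟨j, hj⟩ := hu.1
        refine ⟨j, ?_⟩
        simpa [map_sum, add_assoc] using hV ((1 / 2 : ℝ) • ∑ i, v i + v j + w)
          (by simpa [add_assoc] using hj))
  refine ⟨d, fun x => ?_⟩
  obtain ⟨c, s, rfl⟩ := h.spans x
  have e1 : ⟪∑ i, c i • v i, s • w⟫ = 0 := by
    rw [sum_inner]
    exact Finset.sum_eq_zero fun i _ => by
      rw [inner_smul_left, inner_smul_right, h.orthogonal_axis, mul_zero, mul_zero]
  have e2 : ⟪∑ i, c i • f.linear (v i), s • f.linear w⟫ = 0 := by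
    rw [sum_inner]
    exact Finset.sum_eq_zero fun i _ => by
      rw [inner_smul_left, inner_smul_right, h3, mul_zero, mul_zero]
  simp only [map_add, map_sum, map_smul]
  rw [norm_add_sq_real, norm_add_sq_real, e1, e2, norm_sq_sum_smul_of_orthogonal h1 h2,
    norm_sq_sum_smul_of_orthogonal h.norm_eq_one h.orthogonal, norm_smul, norm_smul, mul_pow,
    mul_pow, h4]
  ring

theorem vectorSpan_eq_top (h : IsLayered V o v w) : vectorSpan ℝ V = ⊤ := by
  classical
  have hs : ∀ x, o + x ∈ V → x ∈ vectorSpan ℝ V := fun x hx => by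
    simpa using vsub_mem_vectorSpan ℝ hx h.origin_mem
  have hpair : ∀ {i j}, i ≠ j → v i + v j ∈ vectorSpan ℝ V := fun {i j} hij => by
    refine hs _ ?_
    rw [← Finset.sum_pair hij]
    exact h.half_finset _ (by rw [Finset.card_pair hij]; exact even_two)
  have hv : ∀ i, v i ∈ vectorSpan ℝ V := fun i => by
    have hc := h.card
    obtain ⟨j, hj⟩ := Finset.exists_mem_notMem_of_card_lt_card (s := {i})
      (t := (Finset.univ : Finset ι)) (by rw [Finset.card_univ, Finset.card_singleton]; omega)
    obtain ⟨k, hk⟩ := Finset.exists_mem_notMem_of_card_lt_card (s := {i, j})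
      (t := (Finset.univ : Finset ι)) (by
        have := Finset.card_le_two (a := i) (b := j)
        rw [Finset.card_univ]; omega)
    simp only [Finset.mem_univ, Finset.mem_singleton, Finset.mem_insert, true_and, not_or] at hj hk
    have : v i = (1 / 2 : ℝ) • ((v i + v j) + (v i + v k) - (v j + v k)) := by module
    rw [this]
    exact Submodule.smul_mem _ _ (Submodule.sub_mem _
      (Submodule.add_mem _ (hpair (Ne.symm hj)) (hpair (Ne.symm hk.1))) (hpair (Ne.symm hk.2)))
  have hc : (1 / 2 : ℝ) • ∑ i, v i ∈ vectorSpan ℝ V :=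
    Submodule.smul_mem _ _ (Submodule.sum_mem _ fun i _ => hv i)
  have hw : w ∈ vectorSpan ℝ V := by
    rcases h.upper with ⟨hu, -⟩ | ⟨⟨j, hu⟩, -⟩
    · have := Submodule.sub_mem _ (hs _ (by rwa [add_assoc] at hu)) hc
      simpa using this
    · have := Submodule.sub_mem _ (hs _ (by rwa [add_assoc, add_assoc] at hu))
        (Submodule.add_mem _ hc (hv j))
      convert this using 1
      abel
  refine eq_top_iff.2 fun x _ => ?_
  obtain ⟨c, s, rfl⟩ := h.spans x
  exact Submodule.add_mem _ (Submodule.sum_mem _ fun i _ => Submodule.smul_mem _ _ (hv i))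
    (Submodule.smul_mem _ _ hw)

theorem affineSpan_eq_top (h : IsLayered V o v w) : affineSpan ℝ V = ⊤ :=
  (AffineSubspace.affineSpan_eq_top_iff_vectorSpan_eq_top_of_nonempty ℝ (E n) (E n)
    ⟨o, h.origin_mem⟩).2 h.vectorSpan_eq_top

theorem finrank_vectorSpan_convexHull (h : IsLayered V o v w) :
    Module.finrank ℝ (vectorSpan ℝ (convexHull ℝ V)) = n := by
  rw [← direction_affineSpan, affineSpan_convexHull, direction_affineSpan, h.vectorSpan_eq_top,
    finrank_top, finrank_euclideanSpace_fin]

end IsLayered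

/-- A ball is strictly convex, so the points of its sphere are extreme in it and in every subset
that contains them. -/
theorem subset_extremePoints_convexHull {V : Set (E n)} {c : E n} {r : ℝ}
    (hV : V ⊆ Metric.sphere c r) : V ⊆ (convexHull ℝ V).extremePoints ℝ := by
  intro x hx
  have hsub : convexHull ℝ V ⊆ Metric.closedBall c r :=
    convexHull_min (hV.trans Metric.sphere_subset_closedBall) (convex_closedBall c r)
  refine inter_extremePoints_subset_extremePoints_of_subset hsub ⟨subset_convexHull ℝ V hx, ?_⟩
  rcases subsingleton_or_nontrivial (E n) with hs | hs
  · exact mem_extremePoints.2 ⟨Metric.sphere_subset_closedBall (hV hx),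
      fun _ _ _ _ _ => ⟨Subsingleton.elim _ _, Subsingleton.elim _ _⟩⟩
  · rw [StrictConvexSpace.extremePoints_closedBall_eq_sphere]
    exact hV hx

/-- An affine bijection whose linear part multiplies all norms by the same factor is a
homothety followed by an isometry. -/
theorem exists_isometry_comp_homothety (f : E n ≃ᵃ[ℝ] E n) {d : ℝ}
    (hd : ∀ x, ‖f.linear x‖ ^ 2 = d * ‖x‖ ^ 2) :
    ∃ (g : E n ≃ᵃⁱ[ℝ] E n) (a : E n) (k : ℝ), 0 < k ∧
      ∀ x, f x = g (AffineMap.homothety a k x) := by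
  obtain ⟨k, hk, hkd⟩ : ∃ k : ℝ, 0 < k ∧ ∀ x, ‖f.linear x‖ = k * ‖x‖ := by
    rcases subsingleton_or_nontrivial (E n) with hs | hs
    · exact ⟨1, one_pos, fun x => by rw [Subsingleton.elim x 0]; simp⟩
    · obtain ⟨x, hx⟩ := exists_ne (0 : E n)
      have h1 : 0 < ‖f.linear x‖ := norm_pos_iff.2 (by simpa using hx)
      have h2 : 0 < ‖x‖ := norm_pos_iff.2 hx
      have hd0 : 0 < d := by
        have := hd x
        by_contra hneg
        nlinarith [pow_pos h1 2, pow_pos h2 2]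
      refine ⟨√d, Real.sqrt_pos.2 hd0, fun y => ?_⟩
      rw [← Real.sqrt_sq (norm_nonneg (f.linear y)), hd, Real.sqrt_mul hd0.le,
        Real.sqrt_sq (norm_nonneg _)]
  let s : E n ≃ᵃ[ℝ] E n := (LinearEquiv.smulOfNeZero ℝ (E n) k⁻¹ (inv_ne_zero hk.ne')).toAffineEquiv
  refine ⟨⟨s.trans f, fun x => ?_⟩, 0, k, hk, fun x => ?_⟩
  · change ‖f.linear (k⁻¹ • x)‖ = ‖x‖
    rw [hkd, norm_smul, norm_inv, Real.norm_eq_abs, abs_of_pos hk, mul_inv_cancel_left₀ hk.ne']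
  · change f x = f (k⁻¹ • AffineMap.homothety 0 k x)
    simp [AffineMap.homothety_apply, smul_smul, hk.ne']

theorem IsLayered.isExtremeDelaunay {ι : Type*} [Fintype ι] {V : Set (E n)} {o w c : E n}
    {v : ι → E n} {r : ℝ} (h : IsLayered V o v w) (hV : V ⊆ Metric.sphere c r)
    (hD : IsDelaunay (convexHull ℝ V)) : IsExtremeDelaunay (convexHull ℝ V) := by
  refine ⟨hD, fun f hf => ?_⟩
  obtain ⟨L, -, -, c', r', -, -, hP⟩ := hf
  -- `f` preserves extreme points, and the extreme points of a Delaunay polytope are among the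
  -- lattice points on its sphere.
  have hmem : ∀ x ∈ V, dist (f x) c' = r' := fun x hx => by
    have h1 : f x ∈ (f '' convexHull ℝ V).extremePoints ℝ := by
      obtain ⟨h2, h3⟩ := mem_extremePoints.1 (subset_extremePoints_convexHull hV hx)
      refine mem_extremePoints.2 ⟨Set.mem_image_of_mem _ h2, ?_⟩
      rintro _ ⟨y, hy, rfl⟩ _ ⟨z, hz, rfl⟩ hyz
      have himg := image_openSegment ℝ (f : E n →ᵃ[ℝ] E n) y z
      simp only [AffineEquiv.coe_coe] at himg
      rw [← himg] at hyz
      obtain ⟨x', hx', he⟩ := hyz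
      rw [f.injective he] at hx'
      exact ⟨congrArg f (h3 y hy z hz hx').1, congrArg f (h3 y hy z hz hx').2⟩
    rw [hP] at h1
    exact (extremePoints_convexHull_subset h1).1
  obtain ⟨d, hd⟩ := h.norm_sq_linear (f : E n →ᵃ[ℝ] E n) hmem
  exact exists_isometry_comp_homothety f hd

/-- Rescaling the axes by `μ` is a continuous injection of `L` into the integer lattice. -/
theorem discreteTopology_of_integral {L : Submodule ℤ (E n)} {μ : Fin n → ℝ} (hμ : ∀ i, μ i ≠ 0)
    (hL : ∀ x ∈ L, ∀ i, ∃ z : ℤ, μ i * x i = z) : DiscreteTopology L := by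
  have hd : DiscreteTopology (Submodule.span ℤ (Set.range (Pi.basisFun ℝ (Fin n)))) :=
    inferInstance
  have hmem : ∀ x : L, (fun i => μ i * (x : E n) i) ∈
      Submodule.span ℤ (Set.range (Pi.basisFun ℝ (Fin n))) := fun x => by
    rw [Module.Basis.mem_span_iff_repr_mem]
    intro i
    obtain ⟨z, hz⟩ := hL x x.2 i
    exact ⟨z, by simp [hz]⟩
  refine DiscreteTopology.of_continuous_injective
    (β := Submodule.span ℤ (Set.range (Pi.basisFun ℝ (Fin n))))
    (f := fun x : L => ⟨_, hmem x⟩) ?_ ?_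
  · exact Continuous.subtype_mk (by fun_prop) _
  · intro x y hxy
    ext i
    exact mul_left_cancel₀ (hμ i) (congrFun (congrArg Subtype.val hxy) i)

/-- An empty sphere in a group whose points have integral coordinates, in suitable units, defines
a Delaunay polytope. -/
theorem isDelaunay_of_integral (L : AddSubgroup (E n)) {μ : Fin n → ℝ} (hμ : ∀ i, μ i ≠ 0)
    (hL : ∀ x ∈ L, ∀ i, ∃ z : ℤ, μ i * x i = z) {c : E n} {r : ℝ}
    (hempty : ∀ x ∈ L, r ≤ dist x c)
    (hspan : affineSpan ℝ (Metric.sphere c r ∩ (L : Set (E n))) = ⊤) :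
    IsDelaunay (convexHull ℝ (Metric.sphere c r ∩ (L : Set (E n)))) := by
  have hd : DiscreteTopology (AddSubgroup.toIntSubmodule L) := discreteTopology_of_integral hμ hL
  refine ⟨AddSubgroup.toIntSubmodule L, hd, ⟨?_⟩, c, r, hempty, hspan, rfl⟩
  have : vectorSpan ℝ (Metric.sphere c r ∩ (L : Set (E n))) = ⊤ := by
    rw [← direction_affineSpan, hspan, AffineSubspace.direction_top]
  rw [eq_top_iff, ← this, vectorSpan, Submodule.span_le]
  rintro _ ⟨x, hx, y, hy, rfl⟩
  exact Submodule.sub_mem _ (Submodule.subset_span hx.2) (Submodule.subset_span hy.2)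

/-- The difference of the squared distances to `c` and `c'` is constant on `V` and affine in the
point, so `c - c'` is orthogonal to all differences of points of `V`. -/
theorem IsCircumcentre.unique {V : Set (E n)} (hV : vectorSpan ℝ V = ⊤) {c c' : E n}
    (h : IsCircumcentre V c) (h' : IsCircumcentre V c') : c = c' := by
  obtain ⟨r, hr⟩ := h
  obtain ⟨r', hr'⟩ := h'
  have hle : vectorSpan ℝ V ≤ (ℝ ∙ (c - c'))ᗮ := by
    rw [vectorSpan, Submodule.span_le]
    rintro _ ⟨x, hx, y, hy, rfl⟩
    rw [SetLike.mem_coe, Submodule.mem_orthogonal_singleton_iff_inner_right]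
    have e : ∀ z ∈ V, ‖z - c‖ ^ 2 - ‖z - c'‖ ^ 2 = r ^ 2 - r' ^ 2 := fun z hz => by
      rw [← dist_eq_norm, ← dist_eq_norm, hr hz, hr' hz]
    have ex := e x hx
    have ey := e y hy
    simp only [norm_sub_sq_real] at ex ey
    simp only [vsub_eq_sub, inner_sub_right, real_inner_comm x, real_inner_comm y]
    linarith
  rw [hV, top_le_iff, Submodule.orthogonal_eq_top_iff, Submodule.span_singleton_eq_bot] at hle
  exact sub_eq_zero.1 hle

theorem circumcentre_eq {V : Set (E n)} (hV : vectorSpan ℝ V = ⊤) {c : E n}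
    (h : IsCircumcentre V c) : circumcentre V = c :=
  IsCircumcentre.unique hV (Classical.epsilon_spec ⟨c, h⟩) h

end Extreme

/-! ### Arithmetic of `point` and `qPoint`. -/

section Coordinates

variable {m : ℕ}

@[simp]
theorem point_castSucc (y : Fin m → ℝ) (h : ℝ) (i : Fin m) : point y h i.castSucc = y i := by
  simp [point]

@[simp]
theorem point_last (y : Fin m → ℝ) (h : ℝ) : point y h (Fin.last m) = h := by
  simp [point]

theorem point_add (y y' : Fin m → ℝ) (h h' : ℝ) :
    point y h + point y' h' = point (y + y') (h + h') := by
  ext i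
  refine Fin.lastCases ?_ (fun i => ?_) i <;> simp

theorem point_sub (y y' : Fin m → ℝ) (h h' : ℝ) :
    point y h - point y' h' = point (y - y') (h - h') := by
  ext i
  refine Fin.lastCases ?_ (fun i => ?_) i <;> simp

theorem point_neg (y : Fin m → ℝ) (h : ℝ) : -point y h = point (-y) (-h) := by
  ext i
  refine Fin.lastCases ?_ (fun i => ?_) i <;> simp

theorem point_smul (a : ℝ) (y : Fin m → ℝ) (h : ℝ) : a • point y h = point (a • y) (a * h) := by
  ext i
  refine Fin.lastCases ?_ (fun i => ?_) i <;> simp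

theorem point_zero : point (0 : Fin m → ℝ) 0 = 0 := by
  ext i
  refine Fin.lastCases ?_ (fun i => ?_) i <;> simp

theorem point_sum {ι : Type*} (s : Finset ι) (y : ι → Fin m → ℝ) (h : ι → ℝ) :
    ∑ i ∈ s, point (y i) (h i) = point (∑ i ∈ s, y i) (∑ i ∈ s, h i) := by
  classical
  induction s using Finset.induction_on with
  | empty => simp [point_zero]
  | insert i s hi ih => rw [Finset.sum_insert hi, ih, point_add, Finset.sum_insert hi,
      Finset.sum_insert hi]

theorem point_eta (x : E (m + 1)) : point (fun i => x i.castSucc) (x (Fin.last m)) = x := by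
  ext i
  refine Fin.lastCases ?_ (fun i => ?_) i <;> simp

theorem inner_point (y y' : Fin m → ℝ) (h h' : ℝ) :
    ⟪point y h, point y' h'⟫ = ∑ i, y i * y' i + h * h' := by
  simp [PiLp.inner_apply, Fin.sum_univ_castSucc, mul_comm]

theorem dist_point_sq (y y' : Fin m → ℝ) (h h' : ℝ) :
    dist (point y h) (point y' h') ^ 2 = ∑ i, (y i - y' i) ^ 2 + (h - h') ^ 2 := by
  rw [dist_eq_norm, point_sub, ← real_inner_self_eq_norm_sq, inner_point]
  simp [sq]

/-- The squared unit of height in `qPoint`. -/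
theorem sqrt_half_sq (hm : 2 ≤ m) :
    (Real.sqrt (((m + 1 : ℕ) : ℝ) - 3) / 2) ^ 2 = ((m : ℝ) - 2) / 4 := by
  have : (2 : ℝ) ≤ m := by exact_mod_cast hm
  rw [div_pow, Real.sq_sqrt (by push_cast; linarith)]
  push_cast
  ring

theorem sqrt_half_pos (hm : 3 ≤ m) : 0 < Real.sqrt (((m + 1 : ℕ) : ℝ) - 3) / 2 := by
  have : (3 : ℝ) ≤ m := by exact_mod_cast hm
  exact half_pos (Real.sqrt_pos.2 (by push_cast; linarith))

theorem qPoint_add (y y' : Fin m → ℝ) (h h' : ℝ) :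
    qPoint y h + qPoint y' h' = qPoint (y + y') (h + h') := by
  rw [qPoint, qPoint, point_add, ← mul_add, qPoint]

theorem qPoint_sub (y y' : Fin m → ℝ) (h h' : ℝ) :
    qPoint y h - qPoint y' h' = qPoint (y - y') (h - h') := by
  rw [qPoint, qPoint, point_sub, ← mul_sub, qPoint]

theorem qPoint_neg (y : Fin m → ℝ) (h : ℝ) : -qPoint y h = qPoint (-y) (-h) := by
  rw [qPoint, point_neg, ← mul_neg, qPoint]

theorem qPoint_smul (a : ℝ) (y : Fin m → ℝ) (h : ℝ) :
    a • qPoint y h = qPoint (a • y) (a * h) := by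
  rw [qPoint, point_smul, mul_left_comm, qPoint]

theorem qPoint_zero : qPoint (0 : Fin m → ℝ) 0 = 0 := by
  rw [qPoint, mul_zero, point_zero]

theorem qPoint_sum {ι : Type*} (s : Finset ι) (y : ι → Fin m → ℝ) (h : ι → ℝ) :
    ∑ i ∈ s, qPoint (y i) (h i) = qPoint (∑ i ∈ s, y i) (∑ i ∈ s, h i) := by
  simp only [qPoint, point_sum, Finset.mul_sum]

theorem inner_qPoint (hm : 2 ≤ m) (y y' : Fin m → ℝ) (h h' : ℝ) :
    ⟪qPoint y h, qPoint y' h'⟫ = ∑ i, y i * y' i + ((m : ℝ) - 2) / 4 * (h * h') := by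
  rw [qPoint, qPoint, inner_point, ← sqrt_half_sq hm]
  ring

theorem dist_qPoint_sq (hm : 2 ≤ m) (y y' : Fin m → ℝ) (h h' : ℝ) :
    dist (qPoint y h) (qPoint y' h') ^ 2 =
      ∑ i, (y i - y' i) ^ 2 + ((m : ℝ) - 2) / 4 * (h - h') ^ 2 := by
  rw [dist_eq_norm, qPoint_sub, ← real_inner_self_eq_norm_sq, inner_qPoint hm]
  simp [sq]

theorem exists_eq_qPoint (hm : 3 ≤ m) (x : E (m + 1)) : ∃ y h, x = qPoint y h := by
  refine ⟨fun i => x i.castSucc, x (Fin.last m) / (Real.sqrt (((m + 1 : ℕ) : ℝ) - 3) / 2), ?_⟩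
  rw [qPoint, mul_div_cancel₀ _ (sqrt_half_pos hm).ne', point_eta]

end Coordinates

/-! ### Parity and minimal values of integer quadratic sums. -/

section IntegerSums

variable {ι : Type*} [Fintype ι]

theorem even_sum_sq_iff (b : ι → ℤ) : Even (∑ i, b i ^ 2) ↔ Even (∑ i, b i) := by
  have h : Even (∑ i, b i ^ 2 + ∑ i, b i) := by
    rw [← Finset.sum_add_distrib]
    exact Finset.even_sum _ fun i _ => by
      rw [show b i ^ 2 + b i = b i * (b i + 1) by ring]
      exact Int.even_mul_succ_self (b i)
  exact Int.even_add.1 h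

theorem sum_mul_pred_nonneg (b : ι → ℤ) : 0 ≤ ∑ i, b i * (b i - 1) :=
  Finset.sum_nonneg fun i _ => by
    rcases le_or_gt (b i) 0 with h | h
    · nlinarith
    · exact mul_nonneg h.le (by omega)

theorem eq_zero_or_one_of_sum_mul_pred {b : ι → ℤ} (h : ∑ i, b i * (b i - 1) = 0) (i : ι) :
    b i = 0 ∨ b i = 1 := by
  have := (Finset.sum_eq_zero_iff_of_nonneg (fun i _ => ?_)).1 h i (Finset.mem_univ i)
  · rcases mul_eq_zero.1 this with h | h <;> omega
  · rcases le_or_gt (b i) 0 with h | h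
    · nlinarith
    · exact mul_nonneg h.le (by omega)

theorem exists_eq_single_of_sum_sq [DecidableEq ι] {b : ι → ℤ} (h : ∑ i, b i ^ 2 = 1) :
    ∃ j, b = Pi.single j 1 ∨ b = -Pi.single j 1 := by
  obtain ⟨j, hj⟩ : ∃ j, b j ≠ 0 := by
    by_contra! hb
    simp [hb] at h
  have hpos : 0 < b j ^ 2 := by positivity
  rw [← Finset.add_sum_erase _ _ (Finset.mem_univ j)] at h
  have hnn : 0 ≤ ∑ i ∈ Finset.univ.erase j, b i ^ 2 := Finset.sum_nonneg fun i _ => sq_nonneg _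
  have hz : ∑ i ∈ Finset.univ.erase j, b i ^ 2 = 0 := by omega
  have hb : ∀ i, i ≠ j → b i = 0 := fun i hi =>
    pow_eq_zero_iff two_ne_zero |>.1 ((Finset.sum_eq_zero_iff_of_nonneg
      (fun i _ => sq_nonneg _)).1 hz i (by simp [hi]))
  have hj1 : b j ^ 2 = 1 := by omega
  refine ⟨j, (sq_eq_one_iff.1 hj1).imp (fun h => ?_) (fun h => ?_)⟩
  all_goals
    ext i
    rcases eq_or_ne i j with rfl | hi
    · simp [h]
    · simp [hb i hi, hi]

end IntegerSums

/-! ### The polytopes `P (N + 1)` for odd `N`. -/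

section EvenDimension

variable {N : ℕ}

/-- The lattice generated by the vertices of `P (N + 1)`, for odd `N`. -/
def pLattice (N : ℕ) : AddSubgroup (E (N + 1)) where
  carrier := {x | ∃ (j : ℤ) (d : Fin N → ℤ), Even (∑ i, d i) ∧
    x = qPoint (fun i => (j : ℝ) / 2 + d i) j}
  zero_mem' := ⟨0, 0, by simp, by rw [← qPoint_zero]; congr 1 <;> simp [funext_iff]⟩
  add_mem' := by
    rintro _ _ ⟨j, d, hd, rfl⟩ ⟨j', d', hd', rfl⟩
    refine ⟨j + j', d + d', by simpa [Finset.sum_add_distrib] using hd.add hd', ?_⟩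
    rw [qPoint_add]
    congr 1
    · ext i
      simp
      ring
    · simp
  neg_mem' := by
    rintro _ ⟨j, d, hd, rfl⟩
    refine ⟨-j, -d, by simpa using hd, ?_⟩
    rw [qPoint_neg]
    congr 1
    · ext i
      simp
      ring
    · simp

/-- The centre of the sphere circumscribed to `P (N + 1)`. -/
noncomputable def pCentre (N : ℕ) : E (N + 1) := qPoint (fun _ => 1 / 2) (-1 / ((N : ℝ) - 2))

/-- The squared radius of the sphere circumscribed to `P (N + 1)`. -/
noncomputable def pRadiusSq (N : ℕ) : ℝ := (N : ℝ) / 4 + 1 / (4 * ((N : ℝ) - 2))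

theorem pRadiusSq_pos (hN : 3 ≤ N) : 0 < pRadiusSq N := by
  have : (3 : ℝ) ≤ N := by exact_mod_cast hN
  have : 0 < (N : ℝ) - 2 := by linarith
  unfold pRadiusSq
  positivity

/-- The centre's height `-1 / (N - 2)` is chosen so that the term linear in `h` is `h / 2`; then the
last bracket, the defect, vanishes on all three layers of vertices. -/
theorem dist_pCentre_sq (hN : 3 ≤ N) (y : Fin N → ℝ) (h : ℝ) :
    dist (qPoint y h) (pCentre N) ^ 2 = pRadiusSq N +
      (∑ i, (y i - 1 / 2) ^ 2 + ((N : ℝ) - 2) / 4 * h ^ 2 + h / 2 - N / 4) := by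
  have : (3 : ℝ) ≤ N := by exact_mod_cast hN
  have : (N : ℝ) - 2 ≠ 0 := by linarith
  rw [pCentre, dist_qPoint_sq (by omega), pRadiusSq]
  generalize ∑ i, (y i - 1 / 2) ^ 2 = s
  field_simp
  ring

theorem qPoint_mem_sphere_iff (hN : 3 ≤ N) (y : Fin N → ℝ) (h : ℝ) :
    qPoint y h ∈ Metric.sphere (pCentre N) √(pRadiusSq N) ↔
      ∑ i, (y i - 1 / 2) ^ 2 + ((N : ℝ) - 2) / 4 * h ^ 2 + h / 2 = N / 4 := by
  rw [Metric.mem_sphere, ← sq_eq_sq₀ dist_nonneg (Real.sqrt_nonneg _),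
    Real.sq_sqrt (pRadiusSq_pos hN).le, dist_pCentre_sq hN]
  constructor <;> intro <;> linarith

theorem defect_even (d : Fin N → ℤ) (k : ℤ) :
    ∑ i, (((2 * k : ℤ) : ℝ) / 2 + d i - 1 / 2) ^ 2 + ((N : ℝ) - 2) / 4 * ((2 * k : ℤ) : ℝ) ^ 2
      + ((2 * k : ℤ) : ℝ) / 2 - N / 4 =
    ((∑ i, (d i + k) * (d i + k - 1) + k * (((N : ℤ) - 2) * k + 1) : ℤ) : ℝ) := by
  have : ∀ i, (((2 * k : ℤ) : ℝ) / 2 + d i - 1 / 2) ^ 2 =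
      ((d i : ℝ) + k) * (d i + k - 1) + 1 / 4 := fun i => by push_cast; ring
  simp only [this, Finset.sum_add_distrib, Finset.sum_const, Finset.card_univ, Fintype.card_fin,
    nsmul_eq_mul]
  push_cast
  ring

theorem defect_odd (d : Fin N → ℤ) (k : ℤ) :
    ∑ i, (((2 * k + 1 : ℤ) : ℝ) / 2 + d i - 1 / 2) ^ 2
      + ((N : ℝ) - 2) / 4 * ((2 * k + 1 : ℤ) : ℝ) ^ 2 + ((2 * k + 1 : ℤ) : ℝ) / 2 - N / 4 =
    ((∑ i, (d i + k) ^ 2 + k * (((N : ℤ) - 2) * (k + 1) + 1) : ℤ) : ℝ) := by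
  have : ∀ i, (((2 * k + 1 : ℤ) : ℝ) / 2 + d i - 1 / 2) ^ 2 = ((d i : ℝ) + k) ^ 2 :=
    fun i => by push_cast; ring
  simp only [this]
  push_cast
  ring

theorem mul_affine_pos {U k : ℤ} (hU : 2 ≤ U) (hk : k ≠ 0) : 0 < k * (U * k + 1) := by
  rcases lt_or_gt_of_ne hk with h | h
  · exact mul_pos_of_neg_of_neg h (by nlinarith)
  · positivity

theorem mul_affine_succ_pos {U k : ℤ} (hU : 2 ≤ U) (h0 : k ≠ 0) (h1 : k ≠ -1) :
    0 < k * (U * (k + 1) + 1) := by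
  rcases lt_or_gt_of_ne h0 with h | h
  · have : k ≤ -2 := by omega
    exact mul_pos_of_neg_of_neg h (by nlinarith)
  · positivity

/-- Modulo 2 the sum is `∑ d i + N k`, that is, `k`. This is where the parity of `N` makes the
spheres empty. -/
theorem sum_add_const_odd_iff (hN : Odd N) {d : Fin N → ℤ} (hd : Even (∑ i, d i)) (k : ℤ) :
    Even (∑ i, (d i + k) ^ 2) ↔ Even k := by
  rw [even_sum_sq_iff, Finset.sum_add_distrib, Int.even_add]
  simp [hd, Int.even_mul, hN]

theorem pLattice_defect (hN : 5 ≤ N) (hodd : Odd N) (j : ℤ) {d : Fin N → ℤ}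
    (hd : Even (∑ i, d i)) :
    0 ≤ ∑ i, ((j : ℝ) / 2 + d i - 1 / 2) ^ 2 + ((N : ℝ) - 2) / 4 * (j : ℝ) ^ 2 + (j : ℝ) / 2 - N / 4 ∧
    (∑ i, ((j : ℝ) / 2 + d i - 1 / 2) ^ 2 + ((N : ℝ) - 2) / 4 * (j : ℝ) ^ 2 + (j : ℝ) / 2 - N / 4 = 0 →
      qPoint (fun i => (j : ℝ) / 2 + d i) j ∈ pVertices (N + 1)) := by
  obtain ⟨k, rfl | rfl⟩ := Int.even_or_odd' j
  · rw [defect_even]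
    have h1 := sum_mul_pred_nonneg (fun i => d i + k)
    rcases eq_or_ne k 0 with rfl | hk
    -- Height 0: the defect is `∑ d i (d i - 1)`, which vanishes exactly on the half-cube.
    · simp only [add_zero, zero_mul] at h1 ⊢
      refine ⟨by exact_mod_cast h1, fun h => Or.inl (Or.inr ?_)⟩
      have h01 := eq_zero_or_one_of_sum_mul_pred (b := d) (by exact_mod_cast h)
      refine ⟨fun i => (d i).toNat, fun i => ?_, ?_, ?_⟩
      · rcases h01 i with h | h <;> simp [h]
      · rw [← Int.even_coe_nat]
        convert hd
        push_cast
        exact Finset.sum_congr rfl fun i _ => by rcases h01 i with h | h <;> simp [h]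
      · congr 1
        · ext i
          rcases h01 i with h | h <;> simp [h]
        · simp
    · have h2 := mul_affine_pos (U := (N : ℤ) - 2) (by omega) hk
      have h3 : 0 < ∑ i, (d i + k) * (d i + k - 1) + k * (((N : ℤ) - 2) * k + 1) := by omega
      exact ⟨by exact_mod_cast h3.le, fun h => absurd h (by exact_mod_cast h3.ne')⟩
  · rw [defect_odd]
    have h1 : 0 ≤ ∑ i, (d i + k) ^ 2 := Finset.sum_nonneg fun i _ => sq_nonneg _
    rcases eq_or_ne k 0 with rfl | hk
    -- Height 1: the defect is `∑ (d i)²`, which vanishes only at the apex.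
    · simp only [add_zero, zero_mul] at h1 ⊢
      refine ⟨by exact_mod_cast h1, fun h => Or.inl (Or.inl ?_)⟩
      have h0 : ∑ i, d i ^ 2 = 0 := by exact_mod_cast h
      rw [Finset.sum_eq_zero_iff_of_nonneg fun i _ => sq_nonneg _] at h0
      have h0' : ∀ i, d i = 0 := fun i => by simpa using h0 i (Finset.mem_univ i)
      simp [h0']
    rcases eq_or_ne k (-1) with rfl | hk'
    -- Height -1: the defect is `∑ (d i - 1)² - 1`. Parity excludes the value -1, and the zeros are
    -- the vertices of the cross-polytope.
    · have hpar := (sum_add_const_odd_iff hodd hd (-1)).not.2 (by decide)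
      have h2 : 1 ≤ ∑ i, (d i + (-1)) ^ 2 := by
        rcases h1.eq_or_lt with h | h
        · exact absurd (h ▸ Even.zero) hpar
        · exact h
      have e : (-1 : ℤ) * (((N : ℤ) - 2) * (-1 + 1) + 1) = -1 := by ring
      rw [e]
      have h3 : 0 ≤ ∑ i, (d i + (-1)) ^ 2 + -1 := by omega
      refine ⟨by exact_mod_cast h3, fun h => Or.inr ?_⟩
      have h4 : ∑ i, (d i + (-1)) ^ 2 + -1 = 0 := by exact_mod_cast h
      obtain ⟨i, hi⟩ := exists_eq_single_of_sum_sq (b := fun i => d i + (-1)) (by omega)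
      refine ⟨i, hi.imp (fun hi => ?_) (fun hi => ?_)⟩
      all_goals
        congr 1
        · ext l
          have h5 := congrArg (Int.cast (R := ℝ)) (congrFun hi l)
          rcases eq_or_ne l i with rfl | hl
          · simp only [Pi.neg_apply, Pi.single_eq_same, Int.cast_neg, Int.cast_one, Int.cast_add] at h5
            simp
            linarith
          · simp only [Pi.neg_apply, Pi.single_eq_of_ne hl, Int.cast_neg, Int.cast_zero, Int.cast_add,
              Int.cast_one] at h5
            simp [hl]
            linarith
        · norm_num
    · have h2 := mul_affine_succ_pos (U := (N : ℤ) - 2) (by omega) hk hk'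
      have h3 : 0 < ∑ i, (d i + k) ^ 2 + k * (((N : ℤ) - 2) * (k + 1) + 1) := by omega
      exact ⟨by exact_mod_cast h3.le, fun h => absurd h (by exact_mod_cast h3.ne')⟩

theorem pLattice_empty (hN : 5 ≤ N) (hodd : Odd N) {x : E (N + 1)} (hx : x ∈ pLattice N) :
    √(pRadiusSq N) ≤ dist x (pCentre N) := by
  obtain ⟨j, d, hd, rfl⟩ := hx
  refine Real.sqrt_le_iff.2 ⟨dist_nonneg, ?_⟩
  rw [dist_pCentre_sq (by omega)]
  linarith [(pLattice_defect hN hodd j hd).1]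

theorem apex_mem : qPoint (fun _ => 1 / 2) 1 ∈ pVertices (N + 1) := Or.inl (Or.inl rfl)

theorem half_cube_mem {x : Fin N → ℕ} (h : ∀ i, x i = 0 ∨ x i = 1) (he : Even (∑ i, x i)) :
    qPoint (fun i => (x i : ℝ)) 0 ∈ pVertices (N + 1) := Or.inl (Or.inr ⟨x, h, he, rfl⟩)

theorem cross_add_mem (j : Fin N) :
    qPoint ((fun _ => (1 / 2 : ℝ)) + Pi.single j 1) (-1) ∈ pVertices (N + 1) :=
  Or.inr ⟨j, Or.inl rfl⟩

theorem cross_sub_mem (j : Fin N) :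
    qPoint ((fun _ => (1 / 2 : ℝ)) - Pi.single j 1) (-1) ∈ pVertices (N + 1) :=
  Or.inr ⟨j, Or.inr rfl⟩

theorem zero_mem_pVertices : (0 : E (N + 1)) ∈ pVertices (N + 1) := by
  have := half_cube_mem (N := N) (x := fun _ => 0) (by simp) (by simp)
  rw [← qPoint_zero]
  convert this using 2
  ext
  simp

theorem pVertices_subset_pLattice (hodd : Odd N) : pVertices (N + 1) ⊆ pLattice N := by
  rintro x ((rfl | ⟨x, h, he, rfl⟩) | ⟨j, rfl | rfl⟩)
  · exact ⟨1, 0, by simp, by congr 1 <;> simp⟩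
  · exact ⟨0, fun i => x i, by simpa using (Int.even_coe_nat _).2 he, by congr 1 <;> simp⟩
  · refine ⟨-1, 1 + Pi.single j 1, ?_, ?_⟩
    · have : Even ((N : ℤ) + 1) := by exact_mod_cast hodd.add_one
      simpa [Finset.sum_add_distrib] using this
    · congr 1
      · ext i
        rcases eq_or_ne i j with rfl | hi
        · simp; norm_num
        · simp [hi]; norm_num
      · simp
  · refine ⟨-1, 1 - Pi.single j 1, ?_, ?_⟩
    · have : Even ((N : ℤ) - 1) := by
        have : Odd (N : ℤ) := by exact_mod_cast hodd
        exact this.sub_odd odd_one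
      simpa [Finset.sum_sub_distrib] using this
    · congr 1
      · ext i
        rcases eq_or_ne i j with rfl | hi
        · simp; norm_num
        · simp [hi]; norm_num
      · simp

theorem pVertices_subset_sphere (hN : 3 ≤ N) :
    pVertices (N + 1) ⊆ Metric.sphere (pCentre N) √(pRadiusSq N) := by
  rintro x ((rfl | ⟨x, h, he, rfl⟩) | ⟨j, rfl | rfl⟩) <;> rw [qPoint_mem_sphere_iff hN]
  · simp
    ring
  · have : ∀ i, ((x i : ℝ) - 1 / 2) ^ 2 = 1 / 4 := fun i => by
      rcases h i with h | h <;> rw [h] <;> norm_num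
    simp only [this, Finset.sum_const, Finset.card_univ, Fintype.card_fin, nsmul_eq_mul]
    ring
  · simp [Pi.single_apply]
    ring
  · simp [Pi.single_apply]
    ring

theorem sphere_inter_pLattice (hN : 5 ≤ N) (hodd : Odd N) :
    Metric.sphere (pCentre N) √(pRadiusSq N) ∩ (pLattice N : Set (E (N + 1))) =
      pVertices (N + 1) := by
  refine Set.Subset.antisymm ?_ fun x hx =>
    ⟨pVertices_subset_sphere (by omega) hx, pVertices_subset_pLattice hodd hx⟩
  rintro _ ⟨hs, j, d, hd, rfl⟩
  rw [qPoint_mem_sphere_iff (by omega)] at hs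
  exact (pLattice_defect hN hodd j hd).2 (sub_eq_zero.2 hs)

theorem sum_smul_qPoint_single (c : Fin N → ℝ) :
    ∑ i, c i • qPoint (Pi.single i 1) 0 = qPoint c 0 := by
  simp only [qPoint_smul, qPoint_sum, mul_zero, Finset.sum_const_zero]
  congr 1
  ext i
  simp [Finset.sum_apply, Pi.single_apply]

theorem isLayered_pVertices (hN : 5 ≤ N) :
    IsLayered (pVertices (N + 1)) 0 (fun i : Fin N => qPoint (Pi.single i 1) 0) (qPoint 0 1) := by
  have hhalf : (1 / 2 : ℝ) • ∑ i, qPoint (Pi.single i 1 : Fin N → ℝ) 0 =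
      qPoint (fun _ => 1 / 2) 0 := by
    rw [← sum_smul_qPoint_single, Finset.smul_sum]
  refine ⟨by simpa using hN, fun x hx he => ?_, fun j => ?_, fun j => ?_, Or.inl ⟨?_, ?_⟩,
    fun i => ?_, fun i j hij => ?_, fun i => ?_, fun x => ?_⟩
  · rw [sum_smul_qPoint_single, zero_add]
    exact half_cube_mem hx he
  · rw [hhalf, zero_add, qPoint_add, qPoint_sub]
    convert cross_add_mem j using 2 <;> simp
  · rw [hhalf, zero_add, qPoint_sub, qPoint_sub]
    convert cross_sub_mem j using 2 <;> simp
  · rw [hhalf, zero_add, qPoint_add]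
    convert apex_mem using 2 <;> simp
  · rw [← real_inner_self_eq_norm_sq, inner_qPoint (by omega)]
    simp
  · rw [← real_inner_self_eq_norm_sq, inner_qPoint (by omega)]
    simp [Pi.single_apply]
  · rw [inner_qPoint (by omega)]
    simp [Pi.single_apply, hij.symm]
  · rw [inner_qPoint (by omega)]
    simp
  · obtain ⟨y, h, rfl⟩ := exists_eq_qPoint (by omega) x
    exact ⟨y, h, by rw [sum_smul_qPoint_single, qPoint_smul, qPoint_add]; simp⟩

theorem pLattice_integral (hN : 3 ≤ N) {x : E (N + 1)} (hx : x ∈ pLattice N) (i : Fin (N + 1)) :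
    ∃ z : ℤ, point (fun _ : Fin N => 2) (Real.sqrt (((N + 1 : ℕ) : ℝ) - 3) / 2)⁻¹ i * x i = z := by
  obtain ⟨j, d, -, rfl⟩ := hx
  refine Fin.lastCases ?_ (fun i => ?_) i
  · exact ⟨j, by rw [qPoint, point_last, point_last, inv_mul_cancel_left₀ (sqrt_half_pos hN).ne']⟩
  · exact ⟨j + 2 * d i, by rw [qPoint, point_castSucc, point_castSucc]; push_cast; ring⟩

theorem isExtremeDelaunay_P (hN : 5 ≤ N) (hodd : Odd N) : IsExtremeDelaunay (P (N + 1)) := by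
  have hl := isLayered_pVertices hN
  refine hl.isExtremeDelaunay (pVertices_subset_sphere (by omega)) ?_
  rw [← sphere_inter_pLattice hN hodd]
  refine isDelaunay_of_integral (pLattice N) ?_ (fun x hx => pLattice_integral (by omega) hx)
    (fun x hx => pLattice_empty hN hodd hx) ?_
  · refine fun i => Fin.lastCases ?_ (fun i => ?_) i
    · rw [point_last]
      exact inv_ne_zero (sqrt_half_pos (by omega)).ne'
    · rw [point_castSucc]
      exact two_ne_zero
  · rw [sphere_inter_pLattice hN hodd]
    exact hl.affineSpan_eq_top

theorem circumcentre_pVertices (hN : 5 ≤ N) : circumcentre (pVertices (N + 1)) = pCentre N :=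
  circumcentre_eq (isLayered_pVertices hN).vectorSpan_eq_top
    ⟨_, pVertices_subset_sphere (by omega)⟩

end EvenDimension

/-! ### Layers of the lattice of a symmetric extension. -/

section SymmetricExtension

variable {m : ℕ}

theorem point_ofLp_add (x x' : E m) (h h' : ℝ) : point (x + x') (h + h') = point x h + point x' h' :=
  (point_add _ _ _ _).symm

/-- The layers of `extLattice V c t`. -/
theorem mem_extLattice {V : Set (E m)} (h0 : 0 ∈ V) {c : E m} {t : ℝ} {x : E (m + 1)} :
    x ∈ extLattice V c t ↔ ∃ l ∈ AddSubgroup.closure V, ∃ k : ℤ,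
      x = point (l + (2 * (k : ℝ)) • c) (k * t) := by
  constructor
  · intro hx
    refine AddSubgroup.closure_induction ?_ ?_ ?_ ?_ hx
    · rintro _ (⟨v, hv, rfl⟩ | ⟨v, hv, rfl⟩)
      · exact ⟨v, AddSubgroup.subset_closure hv, 0, by simp⟩
      · refine ⟨-v, neg_mem (AddSubgroup.subset_closure hv), 1, ?_⟩
        simp [sub_eq_neg_add]
    · exact ⟨0, zero_mem _, 0, by simpa using point_zero.symm⟩
    · rintro _ _ - - ⟨l, hl, k, rfl⟩ ⟨l', hl', k', rfl⟩
      refine ⟨l + l', add_mem hl hl', k + k', ?_⟩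
      rw [← point_ofLp_add]
      push_cast
      congr 2
      · module
      · ring
    · rintro _ - ⟨l, hl, k, rfl⟩
      refine ⟨-l, neg_mem hl, -k, ?_⟩
      rw [point_neg, ← WithLp.ofLp_neg]
      push_cast
      congr 2
      · module
      · ring
  · rintro ⟨l, hl, k, rfl⟩
    have h1 : point l 0 ∈ extLattice V c t := by
      refine AddSubgroup.closure_induction (p := fun (l : E m) _ => point l 0 ∈ extLattice V c t)
        ?_ ?_ ?_ ?_ hl
      · exact fun v hv => AddSubgroup.subset_closure (Or.inl ⟨v, hv, rfl⟩)
      · rw [WithLp.ofLp_zero, point_zero]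
        exact zero_mem _
      · intro x y _ _ hx hy
        have := add_mem hx hy
        rwa [← point_ofLp_add, add_zero] at this
      · intro x _ hx
        have := neg_mem hx
        rwa [point_neg, neg_zero] at this
    -- This is the generator that comes from the reflection of `0 ∈ V`; its multiples reach every
    -- layer.
    have h2 : point ((2 : ℝ) • c) t ∈ extLattice V c t :=
      AddSubgroup.subset_closure (Or.inr ⟨0, h0, by simp⟩)
    have h3 := add_mem h1 (zsmul_mem h2 k)
    convert h3 using 1
    rw [← Int.cast_smul_eq_zsmul ℝ, point_smul, point_add, zero_add]
    congr 1
    ext i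
    simp
    ring

end SymmetricExtension

/-! ### The symmetric extension of `P (N + 1)` for odd `N`. -/

section OddDimension

variable {N : ℕ}

/-- The half-cube gives `e i + e j`, and opposite cross-polytope vertices differ by `2 e i`.
Together these generate the integer vectors with even coordinate sum at height 0; multiples of the
apex reach the other heights. -/
theorem closure_pVertices (hN : 5 ≤ N) (hodd : Odd N) :
    AddSubgroup.closure (pVertices (N + 1)) = pLattice N := by
  refine le_antisymm ((AddSubgroup.closure_le _).2 (pVertices_subset_pLattice hodd)) ?_
  obtain ⟨e, he⟩ : ∃ e : Fin N → E (N + 1), e = fun i => qPoint (Pi.single i 1) 0 := ⟨_, rfl⟩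
  have hsub := AddSubgroup.subset_closure (k := pVertices (N + 1))
  have hdouble : ∀ i, e i + e i ∈ AddSubgroup.closure (pVertices (N + 1)) := fun i => by
    have := sub_mem (hsub (cross_add_mem i)) (hsub (cross_sub_mem i))
    convert this using 1
    rw [he, qPoint_add, qPoint_sub]
    congr 1
    · abel
    · ring
  have hpair : ∀ i j, i ≠ j → e i + e j ∈ AddSubgroup.closure (pVertices (N + 1)) :=
    fun i j hij => by
      have := hsub (half_cube_mem (N := N) (x := Pi.single i 1 + Pi.single j 1) (fun l => by
        rcases eq_or_ne l i with rfl | hl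
        · simp [hij]
        · rcases eq_or_ne l j with rfl | hl' <;> simp [*]) (by simp [Finset.sum_add_distrib]))
      have e1 : e i + e j = qPoint (fun l => (((Pi.single i 1 + Pi.single j 1 : Fin N → ℕ) l : ℕ) : ℝ))
          0 := by
        rw [he, qPoint_add]
        congr 1
        · ext l
          simp [Pi.single_apply]
        · ring
      rwa [e1]
  let z : Fin N := ⟨0, by omega⟩
  have hdiff : ∀ i, e i - e z ∈ AddSubgroup.closure (pVertices (N + 1)) := fun i => by
    rcases eq_or_ne i z with rfl | hi
    · simp
    · have := sub_mem (hpair i z hi) (hdouble z)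
      rwa [add_sub_add_right_eq_sub] at this
  rintro _ ⟨j, d, ⟨s, hs⟩, rfl⟩
  have key : qPoint (fun i => (j : ℝ) / 2 + d i) j =
      j • qPoint (fun _ => 1 / 2) 1 + (∑ i, d i • (e i - e z) + s • (e z + e z)) := by
    have h1 : ∑ i, d i • e i = qPoint (fun i => (d i : ℝ)) 0 := by
      rw [← sum_smul_qPoint_single, he]
      simp only [Int.cast_smul_eq_zsmul]
    have h2 : ∑ i, d i • e z = s • (e z + e z) := by
      rw [← Finset.sum_smul, hs, add_smul, smul_add]
    simp only [smul_sub, Finset.sum_sub_distrib, h1, h2, sub_add_cancel]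
    rw [← Int.cast_smul_eq_zsmul ℝ, qPoint_smul, qPoint_add]
    congr 1
    · ext i
      simp
      ring
    · simp
  rw [key]
  exact add_mem (zsmul_mem (hsub apex_mem) _) (add_mem (sum_mem fun i _ => zsmul_mem (hdiff i) _)
    (zsmul_mem (hdouble z) _))

/-- The point of `ℝᴺ⁺²` with first coordinates `y`, with height `a` in units of `qPoint`, and with
height `b` above the hyperplane of `P (N + 1)`. -/
noncomputable def rPoint (y : Fin N → ℝ) (a b : ℝ) : E (N + 2) := point (qPoint y a) b

theorem rPoint_add (y y' : Fin N → ℝ) (a a' b b' : ℝ) :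
    rPoint y a b + rPoint y' a' b' = rPoint (y + y') (a + a') (b + b') := by
  rw [rPoint, rPoint, ← point_ofLp_add, qPoint_add, rPoint]

theorem rPoint_sub (y y' : Fin N → ℝ) (a a' b b' : ℝ) :
    rPoint y a b - rPoint y' a' b' = rPoint (y - y') (a - a') (b - b') := by
  rw [rPoint, rPoint, point_sub, ← WithLp.ofLp_sub, qPoint_sub, rPoint]

theorem rPoint_smul (s : ℝ) (y : Fin N → ℝ) (a b : ℝ) :
    s • rPoint y a b = rPoint (s • y) (s * a) (s * b) := by
  rw [rPoint, point_smul, ← WithLp.ofLp_smul, qPoint_smul, rPoint]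

theorem inner_rPoint (hN : 2 ≤ N) (y y' : Fin N → ℝ) (a a' b b' : ℝ) :
    ⟪rPoint y a b, rPoint y' a' b'⟫ =
      ∑ i, y i * y' i + ((N : ℝ) - 2) / 4 * (a * a') + b * b' := by
  rw [← inner_qPoint hN, rPoint, rPoint, inner_point]
  simp [PiLp.inner_apply, mul_comm]

theorem exists_eq_rPoint (hN : 3 ≤ N) (x : E (N + 2)) : ∃ y a b, x = rPoint y a b := by
  obtain ⟨y, a, h⟩ := exists_eq_qPoint hN (WithLp.toLp 2 fun i => x i.castSucc)
  exact ⟨y, a, x (Fin.last _), by rw [rPoint, ← h, point_eta]⟩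

theorem sum_smul_rPoint_single (c : Fin N → ℝ) :
    ∑ i, c i • rPoint (Pi.single i 1) 0 0 = rPoint c 0 0 := by
  simp only [rPoint, point_smul, ← WithLp.ofLp_smul, point_sum, ← WithLp.ofLp_sum,
    sum_smul_qPoint_single]
  simp

theorem add_smul_pCentre (y : Fin N → ℝ) (a s : ℝ) : qPoint y a + s • pCentre N =
    qPoint (fun i => y i + s / 2) (a - s / ((N : ℝ) - 2)) := by
  rw [pCentre, qPoint_smul, qPoint_add]
  congr 1
  · ext i
    simp
    ring
  · ring

theorem dist_point_pCentre_sq (v : E (N + 1)) (b b' : ℝ) :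
    dist (point v b) (point (pCentre N) b') ^ 2 = dist v (pCentre N) ^ 2 + (b - b') ^ 2 := by
  rw [dist_point_sq, EuclideanSpace.dist_sq_eq]
  simp [Real.dist_eq]

/-- In the defect, `t` occurs only with the factor `k (k - 1)`, which is zero on the two layers of
the construction. When `t² = 1 - 1/(N - 2)`, the factor after `k (k - 1)` is 1 and no denominator `N
- 2` remains. -/
theorem dist_extLattice_sq (hN : 3 ≤ N) (j k : ℤ) (d : Fin N → ℤ) (t : ℝ) :
    dist (point (qPoint (fun i => (j : ℝ) / 2 + d i) j + (2 * (k : ℝ)) • pCentre N) (k * t))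
      (point (pCentre N) (t / 2)) ^ 2 = pRadiusSq N + t ^ 2 / 4 +
      (∑ i, ((j : ℝ) / 2 + (d i + k) - 1 / 2) ^ 2 + ((N : ℝ) - 2) / 4 * j ^ 2 - j * (2 * k - 1) / 2 +
        k * (k - 1) * (1 / ((N : ℝ) - 2) + t ^ 2) - N / 4) := by
  have : (3 : ℝ) ≤ N := by exact_mod_cast hN
  have : (N : ℝ) - 2 ≠ 0 := by linarith
  have e : ∀ i, (j : ℝ) / 2 + d i + 2 * k / 2 - 1 / 2 = (j : ℝ) / 2 + (d i + k) - 1 / 2 :=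
    fun i => by ring
  rw [dist_point_pCentre_sq, add_smul_pCentre, dist_pCentre_sq hN]
  simp only [e]
  field_simp
  ring

theorem ext_defect_even (d : Fin N → ℤ) (i k : ℤ) :
    ∑ l, (((2 * i : ℤ) : ℝ) / 2 + (d l + k) - 1 / 2) ^ 2 + ((N : ℝ) - 2) / 4 * ((2 * i : ℤ) : ℝ) ^ 2
      - ((2 * i : ℤ) : ℝ) * (2 * k - 1) / 2 + k * (k - 1) - N / 4 =
    ((∑ l, (d l + (i + k)) * (d l + (i + k) - 1) + (((N : ℤ) - 3) * i ^ 2 + (i - k) * (i - k + 1)) :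
      ℤ) : ℝ) := by
  have : ∀ l, (((2 * i : ℤ) : ℝ) / 2 + (d l + k) - 1 / 2) ^ 2 =
      ((d l : ℝ) + (i + k)) * (d l + (i + k) - 1) + 1 / 4 := fun l => by push_cast; ring
  simp only [this, Finset.sum_add_distrib, Finset.sum_const, Finset.card_univ, Fintype.card_fin,
    nsmul_eq_mul]
  push_cast
  ring

theorem ext_defect_odd (d : Fin N → ℤ) (i k : ℤ) :
    ∑ l, (((2 * i + 1 : ℤ) : ℝ) / 2 + (d l + k) - 1 / 2) ^ 2
      + ((N : ℝ) - 2) / 4 * ((2 * i + 1 : ℤ) : ℝ) ^ 2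
      - ((2 * i + 1 : ℤ) : ℝ) * (2 * k - 1) / 2 + k * (k - 1) - N / 4 =
    ((∑ l, (d l + (i + k)) ^ 2 + (((N : ℤ) - 3) * (i * (i + 1)) + (i - k + 1) ^ 2 - 1) : ℤ) : ℝ) := by
  have : ∀ l, (((2 * i + 1 : ℤ) : ℝ) / 2 + (d l + k) - 1 / 2) ^ 2 = ((d l : ℝ) + (i + k)) ^ 2 :=
    fun l => by push_cast; ring
  simp only [this]
  push_cast
  ring

theorem mul_succ_nonneg (i : ℤ) : 0 ≤ i * (i + 1) := by
  rcases le_or_gt 0 i with h | h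
  · positivity
  · exact mul_nonneg_of_nonpos_of_nonpos h.le (by omega)

theorem ext_defect_nonneg (hN : 5 ≤ N) (hodd : Odd N) (j k : ℤ) {d : Fin N → ℤ}
    (hd : Even (∑ i, d i)) :
    0 ≤ ∑ i, ((j : ℝ) / 2 + (d i + k) - 1 / 2) ^ 2 + ((N : ℝ) - 2) / 4 * (j : ℝ) ^ 2
      - (j : ℝ) * (2 * k - 1) / 2 + k * (k - 1) - N / 4 := by
  have hU : 0 ≤ (N : ℤ) - 3 := by omega
  obtain ⟨i, rfl | rfl⟩ := Int.even_or_odd' j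
  · rw [ext_defect_even]
    have h1 := sum_mul_pred_nonneg (fun l => d l + (i + k))
    have h2 := mul_nonneg hU (sq_nonneg i)
    have h3 := mul_succ_nonneg (i - k)
    exact_mod_cast add_nonneg h1 (add_nonneg h2 h3)
  · rw [ext_defect_odd]
    have h1 : 0 ≤ ∑ l, (d l + (i + k)) ^ 2 := Finset.sum_nonneg fun i _ => sq_nonneg _
    have h2 := mul_nonneg hU (mul_succ_nonneg i)
    -- If the second square vanishes, then `i + k = 2 i + 1` is odd, and parity makes the first sum
    -- odd, hence positive. This offsets the `-1` in the defect.
    have h3 : 1 ≤ ∑ l, (d l + (i + k)) ^ 2 + (i - k + 1) ^ 2 := by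
      rcases eq_or_ne (i - k + 1) 0 with h | h
      · have hpar := (sum_add_const_odd_iff hodd hd (i + k)).not.2 (by
          rw [show i + k = 2 * i + 1 by omega]
          simp)
        rcases h1.eq_or_lt with h' | h'
        · exact absurd (h' ▸ Even.zero) hpar
        · rw [h]; omega
      · have : 0 < (i - k + 1) ^ 2 := by positivity
        omega
    have h4 : 0 ≤ ∑ l, (d l + (i + k)) ^ 2 + (((N : ℤ) - 3) * (i * (i + 1)) + (i - k + 1) ^ 2 - 1) := by
      linarith
    exact_mod_cast h4

theorem mem_extLattice_pVertices (hN : 5 ≤ N) (hodd : Odd N) {t : ℝ} {x : E (N + 2)} :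
    x ∈ extLattice (pVertices (N + 1)) (pCentre N) t ↔
      ∃ (j k : ℤ) (d : Fin N → ℤ), Even (∑ i, d i) ∧
        x = point (qPoint (fun i => (j : ℝ) / 2 + d i) j + (2 * (k : ℝ)) • pCentre N) (k * t) := by
  rw [mem_extLattice zero_mem_pVertices, closure_pVertices hN hodd]
  constructor
  · rintro ⟨_, ⟨j, d, hd, rfl⟩, k, rfl⟩
    exact ⟨j, k, d, hd, rfl⟩
  · rintro ⟨j, k, d, hd, rfl⟩
    exact ⟨_, ⟨j, d, hd, rfl⟩, k, rfl⟩

/-- The distance of the two layers in the symmetric extension of `P (N + 1)`. -/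
noncomputable def extHeight (N : ℕ) : ℝ := √(1 - 1 / ((N : ℝ) - 2))

theorem extHeight_sq (hN : 3 ≤ N) : extHeight N ^ 2 = 1 - 1 / ((N : ℝ) - 2) := by
  have : (3 : ℝ) ≤ N := by exact_mod_cast hN
  refine Real.sq_sqrt (sub_nonneg.2 ?_)
  rw [div_le_one] <;> linarith

theorem extHeight_pos (hN : 5 ≤ N) : 0 < extHeight N := by
  have : (5 : ℝ) ≤ N := by exact_mod_cast hN
  refine Real.sqrt_pos.2 (sub_pos.2 ?_)
  rw [div_lt_one] <;> linarith

theorem dist_vertex_sq (hN : 3 ≤ N) {v : E (N + 1)} (hv : v ∈ pVertices (N + 1)) (t : ℝ) :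
    dist (point v 0) (point (pCentre N) (t / 2)) ^ 2 = pRadiusSq N + t ^ 2 / 4 := by
  rw [dist_point_pCentre_sq, pVertices_subset_sphere hN hv, Real.sq_sqrt (pRadiusSq_pos hN).le]
  ring

theorem extVertices_pVertices (hN : 3 ≤ N) (t : ℝ) :
    extVertices (pVertices (N + 1)) (pCentre N) t =
      Metric.sphere (point (pCentre N) (t / 2)) √(pRadiusSq N + t ^ 2 / 4) ∩
        (extLattice (pVertices (N + 1)) (pCentre N) t : Set (E (N + 2))) := by
  have h : ∀ v ∈ pVertices (N + 1), dist (point v 0) (point (pCentre N) (t / 2)) =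
      √(pRadiusSq N + t ^ 2 / 4) := fun v hv => by
    rw [← dist_vertex_sq hN hv, Real.sqrt_sq dist_nonneg]
  ext x
  constructor
  · exact fun hx => ⟨(hx.2 0 zero_mem_pVertices).trans (h 0 zero_mem_pVertices), hx.1⟩
  · exact fun hx => ⟨hx.2, fun v hv => Eq.trans hx.1 (h v hv).symm⟩

theorem mem_extVertices_iff (hN : 3 ≤ N) {t : ℝ} {x : E (N + 2)} :
    x ∈ extVertices (pVertices (N + 1)) (pCentre N) t ↔
      x ∈ extLattice (pVertices (N + 1)) (pCentre N) t ∧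
        dist x (point (pCentre N) (t / 2)) ^ 2 = pRadiusSq N + t ^ 2 / 4 := by
  have h0 : 0 ≤ pRadiusSq N + t ^ 2 / 4 := by
    have := pRadiusSq_pos hN
    positivity
  rw [extVertices_pVertices hN, and_comm (b := _ = _), Set.mem_inter_iff, Metric.mem_sphere,
    ← sq_eq_sq₀ dist_nonneg (Real.sqrt_nonneg _), Real.sq_sqrt h0]
  rfl

theorem extLattice_empty (hN : 5 ≤ N) (hodd : Odd N) {x : E (N + 2)}
    (hx : x ∈ extLattice (pVertices (N + 1)) (pCentre N) (extHeight N)) :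
    pRadiusSq N + extHeight N ^ 2 / 4 ≤ dist x (point (pCentre N) (extHeight N / 2)) ^ 2 := by
  obtain ⟨j, k, d, hd, rfl⟩ := (mem_extLattice_pVertices hN hodd).1 hx
  have := ext_defect_nonneg hN hodd j k hd
  rw [dist_extLattice_sq (by omega), extHeight_sq (by omega), add_sub_cancel, mul_one]
  linarith

/-- The point of the symmetric extension below the two layers. -/
theorem extreme_point_mem (hN : 5 ≤ N) (hodd : Odd N) (t : ℝ) :
    point (qPoint (fun _ : Fin N => ((-1 : ℤ) : ℝ) / 2 + (2 : ℤ)) ((-1 : ℤ) : ℝ) +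
      (2 * ((-1 : ℤ) : ℝ)) • pCentre N) (((-1 : ℤ) : ℝ) * t) ∈
        extLattice (pVertices (N + 1)) (pCentre N) t :=
  (mem_extLattice_pVertices hN hodd).2 ⟨-1, -1, fun _ => 2, by simp, rfl⟩

/-- Here `k (k - 1) = 2`. The point is outside or on the sphere only if `t² ≥ 1 - 1/(N - 2)`, which
bounds the admissible heights from below. -/
theorem dist_extreme_point_sq (hN : 5 ≤ N) (t : ℝ) :
    dist (point (qPoint (fun _ : Fin N => ((-1 : ℤ) : ℝ) / 2 + (2 : ℤ)) ((-1 : ℤ) : ℝ) +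
      (2 * ((-1 : ℤ) : ℝ)) • pCentre N) (((-1 : ℤ) : ℝ) * t)) (point (pCentre N) (t / 2)) ^ 2 =
        pRadiusSq N + t ^ 2 / 4 + 2 * (t ^ 2 - (1 - 1 / ((N : ℝ) - 2))) := by
  rw [dist_extLattice_sq (by omega) (-1) (-1) (fun _ => 2) t]
  norm_num
  ring

theorem isLeast_admissibleHeights (hN : 5 ≤ N) (hodd : Odd N) :
    IsLeast (admissibleHeights (pVertices (N + 1)) (pCentre N)) (extHeight N) := by
  refine ⟨⟨extHeight_pos hN, fun x hx v hv => ?_⟩, fun t ht => ?_⟩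
  · rw [← sq_le_sq₀ dist_nonneg dist_nonneg, dist_vertex_sq (by omega) hv]
    exact extLattice_empty hN hodd hx
  · have h := ht.2 _ (extreme_point_mem hN hodd t) 0 zero_mem_pVertices
    rw [← sq_le_sq₀ dist_nonneg dist_nonneg, dist_vertex_sq (by omega) zero_mem_pVertices,
      dist_extreme_point_sq hN] at h
    exact Real.sqrt_le_iff.2 ⟨ht.1.le, by linarith⟩

theorem hasSymmetricExtension_pVertices (hN : 5 ≤ N) (hodd : Odd N) :
    HasSymmetricExtension (pVertices (N + 1)) := by
  rw [HasSymmetricExtension, circumcentre_pVertices hN]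
  exact ⟨⟨_, pVertices_subset_sphere (by omega)⟩, _, isLeast_admissibleHeights hN hodd⟩

theorem symmetricExtension_pVertices (hN : 5 ≤ N) (hodd : Odd N) :
    symmetricExtension (pVertices (N + 1)) =
      convexHull ℝ (extVertices (pVertices (N + 1)) (pCentre N) (extHeight N)) := by
  rw [symmetricExtension, circumcentre_pVertices hN, (isLeast_admissibleHeights hN hodd).csInf_eq]

theorem bottom_mem_extVertices (hN : 3 ≤ N) {v : E (N + 1)} (hv : v ∈ pVertices (N + 1)) (t : ℝ) :
    point v 0 ∈ extVertices (pVertices (N + 1)) (pCentre N) t :=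
  (mem_extVertices_iff hN).2
    ⟨AddSubgroup.subset_closure (Or.inl ⟨v, hv, rfl⟩), dist_vertex_sq hN hv t⟩

theorem top_mem_extVertices (hN : 3 ≤ N) {v : E (N + 1)} (hv : v ∈ pVertices (N + 1)) (t : ℝ) :
    point ((2 : ℝ) • pCentre N - v) t ∈ extVertices (pVertices (N + 1)) (pCentre N) t := by
  refine (mem_extVertices_iff hN).2 ⟨AddSubgroup.subset_closure (Or.inr ⟨v, hv, rfl⟩), ?_⟩
  have e : dist ((2 : ℝ) • pCentre N - v) (pCentre N) = dist v (pCentre N) := by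
    rw [dist_eq_norm, dist_eq_norm, norm_sub_rev v, two_smul, add_sub_right_comm,
      add_sub_cancel_right]
  rw [← dist_vertex_sq hN hv, dist_point_pCentre_sq, dist_point_pCentre_sq, e]
  ring

theorem rPoint_bottom_mem (hN : 3 ≤ N) {y : Fin N → ℝ} {a : ℝ}
    (h : qPoint y a ∈ pVertices (N + 1)) (t : ℝ) :
    rPoint y a 0 ∈ extVertices (pVertices (N + 1)) (pCentre N) t :=
  bottom_mem_extVertices hN h t

theorem rPoint_top_mem (hN : 3 ≤ N) {y : Fin N → ℝ} {a : ℝ}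
    (h : qPoint y a ∈ pVertices (N + 1)) (t : ℝ) :
    rPoint (1 - y) (-2 / ((N : ℝ) - 2) - a) t ∈ extVertices (pVertices (N + 1)) (pCentre N) t := by
  have := top_mem_extVertices hN h t
  have e : (2 : ℝ) • pCentre N - qPoint y a = qPoint (1 - y) (-2 / ((N : ℝ) - 2) - a) := by
    rw [pCentre, qPoint_smul, qPoint_sub]
    congr 1
    · ext
      simp
    · ring
  rwa [e] at this

/-- The additional edge, indexed by `none`, joins the half-cube to its reflection. Reflection sends
`x` to `1 - x`, which changes the parity of the coordinate sum as `N` is odd, so the two halves form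
a half-cube of dimension `N + 1`. The additional edge has length 1 exactly at the critical height.
-/
theorem isLayered_extVertices (hN : 5 ≤ N) (hodd : Odd N) :
    IsLayered (extVertices (pVertices (N + 1)) (pCentre N) (extHeight N)) 0
      (fun i : Option (Fin N) =>
        i.elim (rPoint 0 (-2 / ((N : ℝ) - 2)) (extHeight N)) fun i => rPoint (Pi.single i 1) 0 0)
      (rPoint 0 (1 - 1 / ((N : ℝ) - 2)) (extHeight N / 2)) := by
  have hN3 : 3 ≤ N := by omega
  have hN5 : (5 : ℝ) ≤ N := by exact_mod_cast hN
  have hU : (N : ℝ) - 2 ≠ 0 := by linarith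
  have ht := extHeight_sq hN3
  have ht0 := (extHeight_pos hN).ne'
  obtain ⟨t, htt⟩ : ∃ t, t = extHeight N := ⟨_, rfl⟩
  rw [← htt] at ht ht0 ⊢
  have hcentre : (1 / 2 : ℝ) • ∑ i : Option (Fin N), (i.elim (rPoint 0 (-2 / ((N : ℝ) - 2)) t)
      fun i => rPoint (Pi.single i 1) 0 0 : E (N + 2)) =
      rPoint (fun _ => 1 / 2) (-1 / ((N : ℝ) - 2)) (t / 2) := by
    have := sum_smul_rPoint_single (fun _ : Fin N => (1 : ℝ))
    simp only [one_smul] at this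
    rw [Fintype.sum_option]
    simp only [Option.elim_none, Option.elim_some]
    rw [this, rPoint_add, rPoint_smul]
    congr 1
    · ext
      simp
    · ring
    · ring
  refine ⟨by simp; omega, fun x hx he => ?_, fun j => ?_, fun j => ?_,
    Or.inr ⟨⟨some ⟨0, by omega⟩, ?_⟩, ?_⟩, fun i => ?_, fun i j hij => ?_, fun i => ?_, fun x => ?_⟩
  · rw [Fintype.sum_option] at he ⊢
    simp only [Option.elim_none, Option.elim_some]
    rw [sum_smul_rPoint_single (fun i => (x (some i) : ℝ)), zero_add]
    rcases hx none with h | h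
    · rw [h, zero_add] at he
      rw [h, Nat.cast_zero, zero_smul, zero_add]
      exact rPoint_bottom_mem hN3 (half_cube_mem (fun i => hx _) he) t
    · have he' : Even (∑ i, (1 - x (some i))) := by
        have h1 : ∑ i, (1 - x (some i)) + ∑ i, x (some i) = N := by
          rw [← Finset.sum_add_distrib, Finset.sum_congr rfl (fun i _ => Nat.sub_add_cancel
            (show x (some i) ≤ 1 by rcases hx (some i) with h | h <;> omega))]
          simp
        rw [h] at he
        rw [Nat.even_iff] at he ⊢
        rw [Nat.odd_iff] at hodd
        omega
      have := rPoint_top_mem hN3 (half_cube_mem (x := fun i => 1 - x (some i)) (fun i => by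
        rcases hx (some i) with h | h <;> simp [h]) he') t
      convert this using 1
      rw [h, Nat.cast_one, one_smul, rPoint_add]
      congr 1
      · ext i
        rcases hx (some i) with h | h <;> simp [h]
      · ring
      · ring
  · rw [hcentre, zero_add]
    cases j with
    | none =>
      simp only [Option.elim_none]
      -- In the direction of the additional edge, the cross-polytope consists of the reflected apex
      -- and, opposite to it, the point of layer `k = -1` that touches the sphere at the critical
      -- height.
      convert rPoint_top_mem hN3 apex_mem t using 1
      rw [rPoint_add, rPoint_sub]
      congr 1
      · ext; simp; norm_num
      · ring
      · ring
    | some j =>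
      simp only [Option.elim_some]
      convert rPoint_bottom_mem hN3 (cross_add_mem j) t using 1
      rw [rPoint_add, rPoint_sub]
      congr 1
      · simp
      · ring
      · ring
  · rw [hcentre, zero_add]
    cases j with
    | none =>
      simp only [Option.elim_none]
      have h1 := dist_extreme_point_sq hN t
      rw [ht, sub_self, mul_zero, add_zero, ← ht] at h1
      convert (mem_extVertices_iff hN3).2 ⟨extreme_point_mem hN hodd t, h1⟩ using 1
      rw [rPoint_sub, rPoint_sub, add_smul_pCentre, rPoint]
      congr 3
      · ext; simp; norm_num
      · push_cast; ring
      · push_cast; ring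
    | some j =>
      simp only [Option.elim_some]
      convert rPoint_bottom_mem hN3 (cross_sub_mem j) t using 1
      rw [rPoint_sub, rPoint_sub]
      congr 1
      · simp
      · ring
      · ring
  · rw [hcentre, zero_add]
    simp only [Option.elim_some]
    -- The point above is a reflected cross-polytope vertex; it lies off the axis by one edge, which
    -- is the second alternative of `upper`.
    convert rPoint_top_mem hN3 (cross_sub_mem ⟨0, by omega⟩) t using 1
    rw [rPoint_add, rPoint_add]
    congr 1
    · ext; simp; ring
    · ring
    · ring
  · rw [← real_inner_self_eq_norm_sq, inner_rPoint (by omega)]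
    simp
    field_simp at ht ⊢
    linear_combination 4 * ht
  · rw [← real_inner_self_eq_norm_sq]
    cases i with
    | none =>
      simp only [Option.elim_none]
      rw [inner_rPoint (by omega)]
      simp
      field_simp at ht ⊢
      linear_combination 4 * ht
    | some i =>
      simp only [Option.elim_some]
      rw [inner_rPoint (by omega)]
      simp [Pi.single_apply]
  · cases i with
    | none =>
      cases j with
      | none => exact absurd rfl hij
      | some j => simp only [Option.elim_none, Option.elim_some]; rw [inner_rPoint (by omega)]; simp
    | some i =>
      simp only [Option.elim_some]
      cases j with
      | none => simp only [Option.elim_none]; rw [inner_rPoint (by omega)]; simp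
      | some j =>
        have : j ≠ i := fun h => hij (by rw [h])
        simp only [Option.elim_some]
        rw [inner_rPoint (by omega)]
        simp [Pi.single_apply, this]
  · cases i with
    | none =>
      simp only [Option.elim_none]
      rw [inner_rPoint (by omega)]
      simp
      field_simp at ht ⊢
      linear_combination 4 * ht
    | some i =>
      simp only [Option.elim_some]
      rw [inner_rPoint (by omega)]
      simp
  · obtain ⟨y, a, b, rfl⟩ := exists_eq_rPoint hN3 x
    -- These are the solutions `p`, `s` of `b = t p + t s / 2` and `a = -2 p / (N - 2) + (1 - 1 / (N
    -- - 2)) s`.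
    refine ⟨fun i => i.elim (b / t - (a + 2 * b / (t * ((N : ℝ) - 2))) / 2) y,
      a + 2 * b / (t * ((N : ℝ) - 2)), ?_⟩
    rw [Fintype.sum_option]
    simp only [Option.elim_none, Option.elim_some]
    rw [sum_smul_rPoint_single, rPoint_smul, rPoint_smul, rPoint_add, rPoint_add]
    congr 1
    · simp
    · field_simp
      ring
    · field_simp
      ring

/-- The extra factor `N - 2` on the second last axis clears the denominator that the shifts by `2 k
c` introduce. -/
theorem extLattice_integral (hN : 5 ≤ N) (hodd : Odd N) {x : E (N + 2)}
    (hx : x ∈ extLattice (pVertices (N + 1)) (pCentre N) (extHeight N)) (i : Fin (N + 2)) :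
    ∃ z : ℤ, point (point (fun _ : Fin N => 2)
      (((N : ℝ) - 2) * (Real.sqrt (((N + 1 : ℕ) : ℝ) - 3) / 2)⁻¹)) (extHeight N)⁻¹ i * x i = z := by
  have hN5 : (5 : ℝ) ≤ N := by exact_mod_cast hN
  have hU : (N : ℝ) - 2 ≠ 0 := by linarith
  obtain ⟨j, k, d, hd, rfl⟩ := (mem_extLattice_pVertices hN hodd).1 hx
  rw [add_smul_pCentre]
  refine Fin.lastCases ?_ (fun i => Fin.lastCases ?_ (fun i => ?_) i) i
  · exact ⟨k, by rw [point_last, point_last, mul_comm, mul_inv_cancel_right₀ (extHeight_pos hN).ne']⟩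
  · refine ⟨((N : ℤ) - 2) * j - 2 * k, ?_⟩
    rw [qPoint, point_castSucc, point_castSucc, point_last, point_last, mul_assoc,
      inv_mul_cancel_left₀ (sqrt_half_pos (by omega)).ne']
    push_cast
    field_simp
  · refine ⟨j + 2 * d i + 2 * k, ?_⟩
    rw [qPoint, point_castSucc, point_castSucc, point_castSucc, point_castSucc]
    push_cast
    ring

theorem isExtremeDelaunay_symmetricExtension (hN : 5 ≤ N) (hodd : Odd N) :
    IsExtremeDelaunay (symmetricExtension (pVertices (N + 1))) := by
  have hN5 : (5 : ℝ) ≤ N := by exact_mod_cast hN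
  have hU : (N : ℝ) - 2 ≠ 0 := by linarith
  have hl := isLayered_extVertices hN hodd
  have hV := extVertices_pVertices (N := N) (by omega) (extHeight N)
  rw [symmetricExtension_pVertices hN hodd]
  refine hl.isExtremeDelaunay (hV.subset.trans Set.inter_subset_left) ?_
  rw [hV]
  refine isDelaunay_of_integral _ ?_ (fun x hx => extLattice_integral hN hodd hx)
    (fun x hx => Real.sqrt_le_iff.2 ⟨dist_nonneg, extLattice_empty hN hodd hx⟩) ?_
  · refine fun i => Fin.lastCases ?_ (fun i => Fin.lastCases ?_ (fun i => ?_) i) i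
    · rw [point_last]
      exact inv_ne_zero (extHeight_pos hN).ne'
    · rw [point_castSucc, point_last]
      exact mul_ne_zero hU (inv_ne_zero (sqrt_half_pos (by omega)).ne')
    · rw [point_castSucc, point_castSucc]
      exact two_ne_zero
  · rw [← hV]
    exact hl.affineSpan_eq_top

end OddDimension

/-! ### Identification of `ED 6` and `ED 7` with polytopes of `E₈` roots. -/

section EEight

/-- The underlying map of `toEEightLinear`. -/
noncomputable def toEEightFun (x : E 7) : E 8 :=
  WithLp.toLp 2 ![-(x 5 / √3 + x 6 * √6 / 6), x 5 / √3 + x 6 * √6 / 6,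
    x 5 / √3 - x 6 * √6 / 3, -x 0, -x 1, -x 2, -x 3, -x 4]

theorem toEEightFun_add (x y : E 7) : toEEightFun (x + y) = toEEightFun x + toEEightFun y := by
  ext i
  fin_cases i <;> simp [toEEightFun] <;> ring

theorem toEEightFun_smul (s : ℝ) (x : E 7) : toEEightFun (s • x) = s • toEEightFun x := by
  ext i
  fin_cases i <;> simp [toEEightFun] <;> ring

theorem norm_toEEightFun (x : E 7) : ‖toEEightFun x‖ = ‖x‖ := by
  have h3 : √(3 : ℝ) ^ 2 = 3 := Real.sq_sqrt (by norm_num)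
  have h6 : √(6 : ℝ) ^ 2 = 6 := Real.sq_sqrt (by norm_num)
  rw [← sq_eq_sq₀ (norm_nonneg _) (norm_nonneg _), EuclideanSpace.norm_sq_eq,
    EuclideanSpace.norm_sq_eq, Fin.sum_univ_eight, Fin.sum_univ_seven]
  simp only [Real.norm_eq_abs, sq_abs]
  simp [toEEightFun]
  ring_nf
  rw [inv_pow, h3, h6]
  ring

/-- The linear part of `toEEight`. -/
noncomputable def toEEightLinear : E 7 →ₗᵢ[ℝ] E 8 where
  toFun := toEEightFun
  map_add' := toEEightFun_add
  map_smul' := toEEightFun_smul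
  norm_map' := norm_toEEightFun

/-- An isometric embedding of `ℝ⁷` into `ℝ⁸` that maps the vertices of the symmetric extension of
`P 6` to the vertices of the Gosset polytope. -/
noncomputable def toEEight : E 7 →ᵃⁱ[ℝ] E 8 :=
  (AffineIsometryEquiv.constVAdd ℝ (E 8) (WithLp.toLp 2 fun _ => (1 / 2 : ℝ))).toAffineIsometry.comp
    toEEightLinear.toAffineIsometry

theorem toEEight_apply (x : E 7) : toEEight x = WithLp.toLp 2 (fun _ => (1 / 2 : ℝ)) +
    WithLp.toLp 2 ![-(x 5 / √3 + x 6 * √6 / 6), x 5 / √3 + x 6 * √6 / 6,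
      x 5 / √3 - x 6 * √6 / 3, -x 0, -x 1, -x 2, -x 3, -x 4] := rfl

theorem toEEight_rPoint (y : Fin 5 → ℝ) (a b : ℝ) : toEEight (rPoint y a b) =
    WithLp.toLp 2 ![1 / 2 - a / 2 - b * √6 / 6, 1 / 2 + a / 2 + b * √6 / 6,
      1 / 2 + a / 2 - b * √6 / 3, 1 / 2 - y 0, 1 / 2 - y 1, 1 / 2 - y 2, 1 / 2 - y 3,
      1 / 2 - y 4] := by
  have h3 : √(3 : ℝ) ≠ 0 := by positivity
  have e6 : rPoint y a b 6 = b := point_last _ _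
  have e5 : rPoint y a b 5 / √3 = a / 2 := by
    have : rPoint y a b 5 = √3 / 2 * a := by
      change point (qPoint y a) b (Fin.castSucc (Fin.last 5)) = _
      rw [point_castSucc, qPoint, point_last]
      norm_num
    rw [this]
    field_simp
  have e : ∀ i : Fin 5, rPoint y a b i.castSucc.castSucc = y i := fun i => by
    rw [rPoint, point_castSucc, qPoint, point_castSucc]
  have e0 : rPoint y a b 0 = y 0 := e 0
  have e1 : rPoint y a b 1 = y 1 := e 1
  have e2 : rPoint y a b 2 = y 2 := e 2
  have e3 : rPoint y a b 3 = y 3 := e 3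
  have e4 : rPoint y a b 4 = y 4 := e 4
  rw [toEEight_apply, e0, e1, e2, e3, e4, e5, e6]
  ext i
  fin_cases i <;> simp <;> ring

theorem extHeight_five_mul : extHeight 5 * √6 = 2 := by
  rw [extHeight, ← Real.sqrt_mul (by norm_num), Real.sqrt_eq_iff_mul_self_eq] <;> norm_num

theorem toEEight_lattice_point (j k : ℤ) (d : Fin 5 → ℤ) :
    toEEight (point (m := 5 + 1)
      (qPoint (fun i => (j : ℝ) / 2 + d i) j + (2 * (k : ℝ)) • pCentre 5 : E (5 + 1))
      (k * extHeight 5)) =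
    WithLp.toLp 2 ![(1 - (j : ℝ)) / 2, (1 + j) / 2, (1 + j) / 2 - k, (1 - j) / 2 - k - d 0,
      (1 - j) / 2 - k - d 1, (1 - j) / 2 - k - d 2, (1 - j) / 2 - k - d 3,
      (1 - j) / 2 - k - d 4] := by
  have h := extHeight_five_mul
  rw [add_smul_pCentre]
  refine (toEEight_rPoint _ _ _).trans ?_
  rw [mul_assoc, h]
  ext i
  fin_cases i <;> simp <;> ring

theorem toEEight_centre : toEEight (point (pCentre 5) (extHeight 5 / 2)) =
    WithLp.toLp 2 ![1 / 2, 1 / 2, 0, 0, 0, 0, 0, 0] := by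
  have h := extHeight_five_mul
  refine (toEEight_rPoint _ _ _).trans ?_
  rw [div_mul_eq_mul_div, h]
  ext i
  fin_cases i <;> simp <;> norm_num

/-- The centre of the extension maps to half the root `e₀ + e₁`, so in this hyperplane the
circumscribed sphere, of squared radius `3/2`, is the condition of squared length 2. -/
theorem dist_half_root_sq {x : E 8} (hx : x 0 + x 1 = 1) :
    dist x (WithLp.toLp 2 ![1 / 2, 1 / 2, 0, 0, 0, 0, 0, 0]) ^ 2 = ∑ i, x i ^ 2 - 1 / 2 := by
  rw [EuclideanSpace.dist_sq_eq, Fin.sum_univ_eight, Fin.sum_univ_eight]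
  simp [Real.dist_eq]
  linear_combination - hx

/-- The roots of `E₈` that have inner product `1` with `e₀ + e₁`, in the coordinates of the
symmetric extension of `P 6`. -/
theorem mem_rootsE8_iff {x : E 8} : x ∈ rootsE8 ∧ x 0 + x 1 = 1 ↔
    ∑ i, x i ^ 2 = 2 ∧ ∃ (j k : ℤ) (d : Fin 5 → ℤ), Even (∑ i, d i) ∧
      x = WithLp.toLp 2 ![(1 - (j : ℝ)) / 2, (1 + j) / 2, (1 + j) / 2 - k, (1 - j) / 2 - k - d 0,
        (1 - j) / 2 - k - d 1, (1 - j) / 2 - k - d 2, (1 - j) / 2 - k - d 3,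
        (1 - j) / 2 - k - d 4] := by
  constructor
  · rintro ⟨⟨hint, ⟨s, hs⟩, hn⟩, h01⟩
    refine ⟨hn, ?_⟩
    -- `ε` is 0 for integral and 1 for half-integral coordinates, which treats both types of roots
    -- at once.
    obtain ⟨a, ε, ha, hε⟩ : ∃ (a : Fin 8 → ℤ) (ε : ℤ), (∀ i, x i = a i + ε / 2) ∧
        1 - a 0 - ε = a 1 := by
      rcases hint with h | h
      · choose a ha using h
        refine ⟨a, 0, fun i => by simp [ha], ?_⟩
        rw [ha, ha] at h01
        replace h01 : (a 0 : ℝ) + a 1 = 1 := h01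
        have : a 0 + a 1 = 1 := by exact_mod_cast h01
        omega
      · choose a ha using h
        refine ⟨a, 1, fun i => by simp [ha], ?_⟩
        rw [ha, ha] at h01
        have : (a 0 : ℝ) + a 1 = 0 := by linarith
        have : a 0 + a 1 = 0 := by exact_mod_cast this
        omega
    have hε' : (a 1 : ℝ) = 1 - a 0 - ε := by exact_mod_cast hε.symm
    -- Solving the coordinate formulas gives `j = 1 - 2 x₀`, `k = x₁ - x₂` and `d i = x₀ - k - x (i
    -- + 3)`.
    refine ⟨1 - 2 * a 0 - ε, a 1 - a 2, fun i => a 0 - (a 1 - a 2) - a (Fin.natAdd 3 i), ?_, ?_⟩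
    · rw [Fin.sum_univ_eight] at hs
      simp only [ha] at hs
      have hs' : a 0 + a 1 + a 2 + a 3 + a 4 + a 5 + a 6 + a 7 + 4 * ε = 2 * s := by
        have : (a 0 + a 1 + a 2 + a 3 + a 4 + a 5 + a 6 + a 7 + 4 * ε : ℝ) = 2 * s := by
          linear_combination hs
        exact_mod_cast this
      rw [Fin.sum_univ_five]
      change Even ((a 0 - (a 1 - a 2) - a 3) + (a 0 - (a 1 - a 2) - a 4) +
        (a 0 - (a 1 - a 2) - a 5) + (a 0 - (a 1 - a 2) - a 6) + (a 0 - (a 1 - a 2) - a 7))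
      rw [Int.even_iff]
      omega
    · have e0 : (Fin.natAdd 3 (0 : Fin 5)) = (3 : Fin 8) := rfl
      have e1 : (Fin.natAdd 3 (1 : Fin 5)) = (4 : Fin 8) := rfl
      have e2 : (Fin.natAdd 3 (2 : Fin 5)) = (5 : Fin 8) := rfl
      have e3 : (Fin.natAdd 3 (3 : Fin 5)) = (6 : Fin 8) := rfl
      have e4 : (Fin.natAdd 3 (4 : Fin 5)) = (7 : Fin 8) := rfl
      ext i
      rw [ha]
      fin_cases i <;> simp [e0, e1, e2, e3, e4, hε'] <;> ring
  · rintro ⟨hn, j, k, d, ⟨s, hs⟩, rfl⟩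
    -- The coordinate sum is `4 - 2 j - 6 k - ∑ d i`, with `∑ d i = 2 s`.
    refine ⟨⟨?_, ⟨2 - j - 3 * k - s, ?_⟩, hn⟩, ?_⟩
    · obtain ⟨i, rfl | rfl⟩ := Int.even_or_odd' j
      · refine Or.inr fun l => ?_
        refine ⟨![-i, i, i - k, -i - k - d 0, -i - k - d 1, -i - k - d 2, -i - k - d 3,
          -i - k - d 4] l, ?_⟩
        fin_cases l <;> simp <;> ring
      · refine Or.inl fun l => ?_
        refine ⟨![-i, i + 1, i + 1 - k, -i - k - d 0, -i - k - d 1, -i - k - d 2, -i - k - d 3,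
          -i - k - d 4] l, ?_⟩
        fin_cases l <;> simp <;> ring
    · rw [Fin.sum_univ_five] at hs
      have hs' : (d 0 + d 1 + d 2 + d 3 + d 4 : ℝ) = s + s := by exact_mod_cast hs
      rw [Fin.sum_univ_eight]
      simp
      linear_combination - hs'
    · simp
      ring

theorem image_extVertices : toEEight '' extVertices (pVertices 6) (pCentre 5) (extHeight 5) =
    {x | x ∈ rootsE8 ∧ x 0 + x 1 = 1} := by
  have hodd : Odd 5 := by decide
  have hR : pRadiusSq 5 + extHeight 5 ^ 2 / 4 = 2 - 1 / 2 := by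
    rw [extHeight_sq (by norm_num), pRadiusSq]
    norm_num
  have key : ∀ {x : E 7}, toEEight x 0 + toEEight x 1 = 1 →
      (dist x (point (pCentre 5) (extHeight 5 / 2)) ^ 2 = pRadiusSq 5 + extHeight 5 ^ 2 / 4 ↔
        ∑ i, toEEight x i ^ 2 = 2) := fun {x} hx => by
    rw [← toEEight.dist_map, toEEight_centre, dist_half_root_sq hx, hR, sub_left_inj]
  ext x
  rw [Set.mem_ofPred_eq, mem_rootsE8_iff]
  constructor
  · rintro ⟨x, hx, rfl⟩
    obtain ⟨hl, hs⟩ := (mem_extVertices_iff (by norm_num)).1 hx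
    obtain ⟨j, k, d, hd, rfl⟩ := (mem_extLattice_pVertices le_rfl hodd).1 hl
    have e := toEEight_lattice_point j k d
    exact ⟨(key (by rw [e]; simp; ring)).1 hs, j, k, d, hd, e⟩
  · rintro ⟨hn, j, k, d, hd, h⟩
    have e := toEEight_lattice_point j k d
    rw [← h] at e
    refine ⟨_, (mem_extVertices_iff (by norm_num)).2 ⟨(mem_extLattice_pVertices le_rfl hodd).2
      ⟨j, k, d, hd, rfl⟩, (key ?_).2 ?_⟩, e⟩
    · rw [e, h]
      simp
      ring
    · rw [e, hn]

/-- The embedding of `ℝᵐ` into `ℝᵐ⁺¹` as the hyperplane at height `0`. -/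
noncomputable def bottom (m : ℕ) : E m →ₗᵢ[ℝ] E (m + 1) where
  toFun x := point x 0
  map_add' x y := by rw [← point_ofLp_add, add_zero]
  map_smul' s x := by rw [RingHom.id_apply, point_smul, mul_zero, WithLp.ofLp_smul]
  norm_map' x := by
    change ‖point x 0‖ = ‖x‖
    rw [← sq_eq_sq₀ (norm_nonneg _) (norm_nonneg _), EuclideanSpace.norm_sq_eq,
      EuclideanSpace.norm_sq_eq, Fin.sum_univ_castSucc]
    simp

theorem image_pVertices : (toEEight.comp (bottom 6).toAffineIsometry) '' pVertices 6 =
    {x | x ∈ rootsE8 ∧ x 0 + x 1 = 1 ∧ x 0 + x 2 = 1} := by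
  have hodd : Odd 5 := by decide
  -- The inner product with `e₀ + e₂` reads off the layer, so the second root condition selects
  -- layer `k = 0`, the copy of `pVertices 6`.
  have h02 : ∀ j k : ℤ, ∀ d : Fin 5 → ℤ, ∀ x : E 7,
      x = point (m := 5 + 1)
      (qPoint (fun i => (j : ℝ) / 2 + d i) j + (2 * (k : ℝ)) • pCentre 5 : E (5 + 1))
        (k * extHeight 5) → toEEight x 0 + toEEight x 2 = 1 - k := by
    rintro j k d _ rfl
    rw [toEEight_lattice_point]
    simp
    ring
  have hroots := Set.ext_iff.1 image_extVertices
  ext x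
  rw [Set.mem_ofPred_eq, ← and_assoc]
  constructor
  · rintro ⟨v, hv, rfl⟩
    refine ⟨(hroots _).1 ⟨_, bottom_mem_extVertices (by norm_num) hv _, rfl⟩, ?_⟩
    obtain ⟨j, d, -, rfl⟩ := pVertices_subset_pLattice hodd hv
    have := h02 j 0 d _ rfl
    simp only [Int.cast_zero, mul_zero, zero_smul, add_zero, zero_mul, sub_zero] at this
    exact this
  · rintro ⟨h1, h2⟩
    obtain ⟨x, hx, rfl⟩ := (hroots x).2 h1
    obtain ⟨hl, hs⟩ := (mem_extVertices_iff (by norm_num)).1 hx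
    obtain ⟨j, k, d, hd, hjk⟩ := (mem_extLattice_pVertices le_rfl hodd).1 hl
    have hk := h02 j k d _ hjk
    rw [h2] at hk
    obtain rfl : k = 0 := by
      have : (k : ℝ) = 0 := by linarith
      exact_mod_cast this
    simp only [Int.cast_zero, mul_zero, zero_smul, add_zero, zero_mul] at hjk
    refine ⟨qPoint (fun i => (j : ℝ) / 2 + d i) j, ?_, congrArg toEEight hjk.symm⟩
    rw [← sphere_inter_pLattice le_rfl hodd]
    refine ⟨?_, j, d, hd, rfl⟩
    rw [hjk, dist_point_pCentre_sq] at hs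
    rw [Metric.mem_sphere, ← sq_eq_sq₀ dist_nonneg (Real.sqrt_nonneg _),
      Real.sq_sqrt (pRadiusSq_pos (by norm_num)).le]
    linarith

theorem congruent_convexHull {m n : ℕ} {V : Set (E m)} {W : Set (E n)} (f : E m →ᵃⁱ[ℝ] E n)
    (h : f '' V = W) : Congruent (convexHull ℝ V) (convexHull ℝ W) :=
  ⟨f, by rw [← h]; exact AffineMap.image_convexHull f.toAffineMap V⟩

theorem congruent_schlafli : Congruent (P 6) schlafli := congruent_convexHull _ image_pVertices

theorem congruent_gosset : Congruent (symmetricExtension (pVertices 6)) gosset := by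
  rw [symmetricExtension_pVertices le_rfl (by decide)]
  exact congruent_convexHull _ image_extVertices

end EEight

theorem ED_of_even {n : ℕ} (hn : Even n) : ED n = P n := by
  cases n with
  | zero => rfl
  | succ m => exact if_pos hn

theorem ED_of_odd {m : ℕ} (hm : Even m) : ED (m + 1) = symmetricExtension (pVertices m) :=
  if_neg (by rw [Nat.even_add_one]; exact not_not.2 hm)

end ExtremeDelaunay

open ExtremeDelaunay

theorem corollary1 :
    (∀ n : ℕ, 6 ≤ n →
      ExtremeDelaunay.IsExtremeDelaunay (ExtremeDelaunay.ED n) ∧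
      Module.finrank ℝ (vectorSpan ℝ (ExtremeDelaunay.ED n)) = n) ∧
    (∀ n : ℕ, 6 ≤ n → Even n → ExtremeDelaunay.ED n = ExtremeDelaunay.P n) ∧
    (∀ m : ℕ, 6 ≤ m → Even m →
      ExtremeDelaunay.HasSymmetricExtension (ExtremeDelaunay.pVertices m) ∧
      ExtremeDelaunay.ED (m + 1) =
        ExtremeDelaunay.symmetricExtension (ExtremeDelaunay.pVertices m)) ∧
    ExtremeDelaunay.Congruent (ExtremeDelaunay.ED 6) ExtremeDelaunay.schlafli ∧
    ExtremeDelaunay.Congruent (ExtremeDelaunay.ED 7) ExtremeDelaunay.gosset := by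
  have hpred : ∀ n : ℕ, 6 ≤ n → Even n → ∃ N, n = N + 1 ∧ 5 ≤ N ∧ Odd N := fun n hn he =>
    ⟨n - 1, by omega, by omega, Nat.Even.sub_odd (by omega) he odd_one⟩
  refine ⟨fun n hn => ?_, fun n _ he => ED_of_even he, fun m hm he => ⟨?_, ED_of_odd he⟩, ?_, ?_⟩
  · rcases Nat.even_or_odd n with he | ho
    · obtain ⟨N, rfl, hN, hodd⟩ := hpred n hn he
      rw [ED_of_even he]
      exact ⟨isExtremeDelaunay_P hN hodd, (isLayered_pVertices hN).finrank_vectorSpan_convexHull⟩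
    · obtain ⟨m, rfl⟩ : ∃ m, n = m + 1 := ⟨n - 1, by omega⟩
      have he : Even m := by
        rw [Nat.odd_add_one, Nat.not_odd_iff_even] at ho
        exact ho
      have hm : m ≠ 5 := by
        rintro rfl
        exact absurd he (by decide)
      obtain ⟨N, rfl, hN, hodd⟩ := hpred m (by omega) he
      rw [ED_of_odd he]
      refine ⟨isExtremeDelaunay_symmetricExtension hN hodd, ?_⟩
      rw [symmetricExtension_pVertices hN hodd]
      exact (isLayered_extVertices hN hodd).finrank_vectorSpan_convexHull
  · obtain ⟨N, rfl, hN, hodd⟩ := hpred m hm he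
    exact hasSymmetricExtension_pVertices hN hodd
  · rw [ED_of_even (by decide)]
    exact congruent_schlafli
  · rw [ED_of_odd (by decide)]
    exact congruent_gosset
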